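/- For $u=(u_1,u_2)\in\mathbb R^2$ write $u^\perp=(u_2,-u_1)$. Let $b\in C^\infty(\mathbb R^2)\cap W^{2,\infty}(\mathbb R^2)$ with $\inf_{\mathbb R^2} b>0$, let $s\ge 1$ be real and let $u_0\in W^{s,\infty}(\mathbb R^2)$ be a vector field. For $\varepsilon>0$ consider the system $$\partial_t u_\varepsilon+(u_\varepsilon\cdot\nabla)u_\varepsilon+\frac{b}{\varepsilon}\,u_\varepsilon^\perp=0,\qquad u_\varepsilon(0)=u_0 .\tag{B}$$ A solution of (B) in $L^\infty([0,T],W^{r,\infty}(\mathbb R^2))$, $r\ge1$, is understood in the strong sense (the equation holds almost everywhere) and is identified with its Lipschitz representative on $[0,T]\times\mathbb R^2$. (1) There is $T^*\in\,]0,+\infty]$ such that for every $0<T<T^*$ there is $\varepsilon_T>0$ such that, for all $0<\varepsilon\le\varepsilon_T$, (B) has a unique solution in $L^\infty([0,T],W^{1,\infty}(\mathbb R^2))$. (2) Let $1\le r\le s$, let $T>0$ and $\varepsilon_T>0$, and let $u_\varepsilon\in L^\infty([0,T],W^{r,\infty}(\mathbb R^2))$ be a solution of (B) for every $0<\varepsilon\le\varepsilon_T$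 (by (1) this applies to every $T<T^*$ with $r=1$). Then for almost every $x\in\mathbb R^2$, all $0<\varepsilon\le\varepsilon_T$ and all $t\in[0,T]$ the equation $$\theta_\varepsilon(t,x)=\frac{b(x)t}{\varepsilon}-t\,u_0(x)\cdot\nabla\log b(x)\,\sin\theta_\varepsilon(t,x)-t\,u_0^\perp(x)\cdot\nabla\log b(x)\,\cos\theta_\varepsilon(t,x)$$ has exactly one real solution $\theta_\varepsilon(t,x)$, and, as $\varepsilon\to0$, $$u_\varepsilon(t,x)-\bigl(u_0(x)\cos\theta_\varepsilon(t,x)-u_0^\perp(x)\sin\theta_\varepsilon(t,x)\bigr)\longrightarrow 0\quad\text{in } L^\infty([0,T]\times\mathbb R^2).$$ -/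

import Mathlib

open MeasureTheory Filter Topology
open scoped ENNReal ContDiff

/-- The Euclidean plane `ℝ²`. -/
abbrev Plane : Type := EuclideanSpace ℝ (Fin 2)

/-- The rotated vector `u^⊥ = (u₂, -u₁)`. -/
noncomputable def perp (u : Plane) : Plane := !₂[u 1, -u 0]

/-- `G` is the weak (distributional) derivative of `f : ℝ² → F`: integration by parts holds
against every test function and in every direction. -/
def HasWeakFDeriv {F : Type} [NormedAddCommGroup F] [NormedSpace ℝ F]
    (f : Plane → F) (G : Plane → Plane →L[ℝ] F) : Prop :=
  ∀ φ : Plane → ℝ, ContDiff ℝ ∞ φ → HasCompactSupport φ → ∀ v : Plane,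
    ∫ x, (fderiv ℝ φ x v) • f x = - ∫ x, φ x • G x v

/-- `WInfBound k σ F f C`: the weak derivatives of `f` of order at most `k` exist and are bounded
by `C` almost everywhere, and those of order `k` are moreover Hölder continuous with exponent `σ`
and constant `C`, off a null set. For `σ = 0` the Hölder condition follows from boundedness
(up to the factor two in the constant). -/
def WInfBound : ℕ → ℝ → (F : Type) → [NormedAddCommGroup F] → [NormedSpace ℝ F] →
    (Plane → F) → ℝ → Prop
  | 0, σ, _, _, _, f, C =>
      AEStronglyMeasurable f volume ∧ (∀ᵐ x, ‖f x‖ ≤ C) ∧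
        ∀ᵐ p : Plane × Plane, ‖f p.1 - f p.2‖ ≤ C * ‖p.1 - p.2‖ ^ σ
  | k + 1, σ, F, _, _, f, C =>
      AEStronglyMeasurable f volume ∧ (∀ᵐ x, ‖f x‖ ≤ C) ∧
        ∃ G : Plane → Plane →L[ℝ] F, HasWeakFDeriv f G ∧ WInfBound k σ (Plane →L[ℝ] F) G C

/-- `f` lies in a ball of radius comparable to `C` of the Sobolev (Slobodeckij) space
`W^{s,∞}(ℝ²)`, for real `s ≥ 0`. -/
def SobolevInfBound {F : Type} [NormedAddCommGroup F] [NormedSpace ℝ F]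
    (s : ℝ) (f : Plane → F) (C : ℝ) : Prop :=
  WInfBound ⌊s⌋₊ (s - ⌊s⌋₊) F f C

/-- Membership in `W^{s,∞}(ℝ²)`, for real `s ≥ 0`. -/
def MemSobolevInf {F : Type} [NormedAddCommGroup F] [NormedSpace ℝ F]
    (s : ℝ) (f : Plane → F) : Prop :=
  ∃ C : ℝ, SobolevInfBound s f C

/-- `u` is, on `[0,T] × ℝ²`, a strong solution in `L^∞([0,T], W^{s,∞}(ℝ²))` of
`∂ₜu + (u·∇)u + (b/ε) u^⊥ = 0`, `u(0) = u₀`. The equation bounds `∂ₜu` as soon as `s ≥ 1`, so a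
solution has a Lipschitz representative on `[0,T] × ℝ²`, and `u` stands for that one. The values
of `u` outside `[0,T]` play no role. -/
structure IsBurgersSolution (s ε T : ℝ) (b : Plane → ℝ) (u₀ : Plane → Plane)
    (u : ℝ → Plane → Plane) : Prop where
  lipschitz : ∃ K, LipschitzOnWith K (fun p : ℝ × Plane => u p.1 p.2)
    (Set.Icc 0 T ×ˢ Set.univ)
  bounded : ∃ C : ℝ, ∀ᵐ t ∂(volume.restrict (Set.Icc 0 T)), SobolevInfBound s (u t) C
  initial : u 0 =ᵐ[volume] u₀
  equation : ∀ᵐ p : ℝ × Plane ∂(volume.restrict (Set.Ioo 0 T ×ˢ Set.univ)),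
    ∃ (dt : Plane) (dx : Plane →L[ℝ] Plane),
      HasDerivAt (fun τ => u τ p.2) dt p.1 ∧ HasFDerivAt (u p.1) dx p.2 ∧
        dt + dx (u p.1 p.2) + (b p.2 / ε) • perp (u p.1 p.2) = 0

/-- The implicit equation for the phase `θ` at time `t` and at the point `x`. -/
def IsPhase (ε : ℝ) (b : Plane → ℝ) (u₀ : Plane → Plane) (t : ℝ) (x : Plane) (θ : ℝ) : Prop :=
  θ = b x * t / ε
    - t * inner ℝ (u₀ x) (gradient (fun y => Real.log (b y)) x) * Real.sin θ
    - t * inner ℝ (perp (u₀ x)) (gradient (fun y => Real.log (b y)) x) * Real.cos θ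

/-!
The equation is solved by characteristics. Along `X' = u(t, X)` the velocity `V` satisfies
`V' = -(b(X)/ε) V^⊥`, so the speed is conserved and `V = rot φ u₀(x)`, where the phase satisfies
`φ' = b(X)/ε`. The pair `(X, φ)` solves a system with bounded Lipschitz right-hand side
(`IsCharacteristic`), and the whole theorem is about these curves.

*Drift.* Comparing the motion with gyration in the constant field `b(x)` gives `X - x = O(ε)`
(`IsCharacteristic.norm_position_sub_le`). The component of the drift along `∇b` is even `O(ε²)`,
apart from the gyration itself: with the gradient frozen at `x`, this is an exact energy-type
identity up to `O(ε²)` (`IsCharacteristic.abs_field_sub_le`), so only `b ∈ W^{2,∞}` is needed and no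
averaging. Integrating `φ' = b(X)/ε` and expressing everything at the point `y = X(t)` yields the
implicit phase equation up to `O(ε)` (`exists_phase_bound`).

*Existence.* The difference of the displacements `X - x` of two particles is `O(T + ε)` times their
distance (`exists_displacement_bound`): the phases differ by `O(1/ε)`, but they enter through a
gyration of radius `O(ε)`. For small `T` and `ε` the flow of the characteristics is therefore a
bi-Lipschitz homeomorphism, and transporting the velocity by it gives a Lipschitz function, which
satisfies the equation wherever it is differentiable, that is almost everywhere by Rademacher's
theorem (`exists_isBurgersSolution`).

*Uniqueness.* Conversely, a Lipschitz solution `u` has a bi-Lipschitz flow, so that the exceptional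
null set is avoided at almost all times by almost all of its trajectories; on those `u`, rotated
back by the phase, is Lipschitz in time with derivative zero almost everywhere. By continuity all
trajectories are characteristics and carry `u` (`IsBurgersSolution.exists_transport`).

*The phase equation.* It reads `F(θ) = b t / ε` with `F(θ) = θ + t ∇log b · (rot θ u₀)^⊥`, and `F` is
increasing if and only if `t |∇log b| |u₀| ≤ 1`. That this holds up to the time `T` follows from
the existence of the solutions alone (`mul_norm_logFDeriv_le_one`): the phase carried by the flow
depends continuously on the position, and by the intermediate value theorem it would otherwise
cross an interval on which `F` decreases while `b T / ε` increases. Below the critical time `F` is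
a homeomorphism whose inverse has a modulus of continuity independent of all data, because
`|F(θ) - F(θ')| ≥ |θ - θ'| - 2 |sin((θ - θ')/2)|`. Hence the exact phase is `o(1)`-close to the
phase of the solution, uniformly, also in the degenerate case of equality.
-/

/-! ### Rotations of the plane -/

/-- The map `u ↦ u^⊥` as a continuous linear map. -/
noncomputable def perpL : Plane →L[ℝ] Plane :=
  LinearMap.toContinuousLinearMap
    { toFun := perp
      map_add' := fun u v => by ext i; fin_cases i <;> simp [perp]; ring
      map_smul' := fun c u => by ext i; fin_cases i <;> simp [perp] }

@[simp] theorem perpL_apply (u : Plane) : perpL u = perp u := rfl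

theorem perp_neg (u : Plane) : perp (-u) = -perp u := perpL.map_neg u

theorem perp_sub (u v : Plane) : perp (u - v) = perp u - perp v := perpL.map_sub u v

theorem perp_smul (c : ℝ) (u : Plane) : perp (c • u) = c • perp u := perpL.map_smul c u

@[simp] theorem perp_perp (u : Plane) : perp (perp u) = -u := by
  ext i; fin_cases i <;> simp [perp]

@[simp] theorem norm_perp (u : Plane) : ‖perp u‖ = ‖u‖ := by
  simp [EuclideanSpace.norm_eq, perp, Fin.sum_univ_two, add_comm]

/-- In the orthogonal frame `w`, `w^⊥` Parseval's identity reads as follows. -/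
theorem inner_sq_add_inner_perp_sq (w g : Plane) :
    inner ℝ w g ^ 2 + inner ℝ (perp w) g ^ 2 = (‖w‖ * ‖g‖) ^ 2 := by
  rw [mul_pow, EuclideanSpace.norm_sq_eq, EuclideanSpace.norm_sq_eq]
  simp [perp, PiLp.inner_apply, Fin.sum_univ_two]; ring

/-- The vector `w` rotated by the angle `φ`, clockwise: the solution at phase `φ` of
`dV/dφ = -V^⊥`, `V(0) = w`. -/
noncomputable def rot (φ : ℝ) (w : Plane) : Plane := Real.cos φ • w - Real.sin φ • perp w

@[simp] theorem rot_zero (w : Plane) : rot 0 w = w := by simp [rot]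

theorem perp_rot (φ : ℝ) (w : Plane) :
    perp (rot φ w) = Real.cos φ • perp w + Real.sin φ • w := by
  simp [rot, perp_sub, perp_smul]

theorem rot_sub (φ : ℝ) (v w : Plane) : rot φ (v - w) = rot φ v - rot φ w := by
  simp only [rot, perp_sub, smul_sub]; abel

theorem norm_rot (φ : ℝ) (w : Plane) : ‖rot φ w‖ = ‖w‖ := by
  rw [← sq_eq_sq₀ (norm_nonneg _) (norm_nonneg _), EuclideanSpace.norm_sq_eq,
    EuclideanSpace.norm_sq_eq]
  simp only [rot, perp, Real.norm_eq_abs, sq_abs, Fin.sum_univ_two]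
  simp
  linear_combination (w 0 ^ 2 + w 1 ^ 2) * Real.sin_sq_add_cos_sq φ

theorem rot_rot (φ ψ : ℝ) (w : Plane) : rot φ (rot ψ w) = rot (φ + ψ) w := by
  rw [rot, perp_rot, rot, rot, Real.cos_add, Real.sin_add]
  module

theorem rot_rot_neg (φ : ℝ) (w : Plane) : rot φ (rot (-φ) w) = w := by
  rw [rot_rot]; simp

theorem hasDerivAt_rot (φ : ℝ) (w : Plane) :
    HasDerivAt (fun a => rot a w) (-perp (rot φ w)) φ := by
  have h := ((Real.hasDerivAt_cos φ).smul_const w).sub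
    ((Real.hasDerivAt_sin φ).smul_const (perp w))
  refine h.congr_deriv ?_
  rw [perp_rot]; module

theorem norm_rot_sub_rot_le (φ ψ : ℝ) (w : Plane) : ‖rot φ w - rot ψ w‖ ≤ ‖w‖ * |φ - ψ| := by
  have := Convex.norm_image_sub_le_of_norm_hasDerivWithin_le (f := fun a => rot a w)
    (f' := fun a => -perp (rot a w)) (C := ‖w‖) (s := Set.univ) (x := ψ) (y := φ)
    (fun x _ => (hasDerivAt_rot x w).hasDerivWithinAt)
    (fun x _ => by rw [norm_neg, norm_perp, norm_rot]) convex_univ trivial trivial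
  simpa using this

theorem norm_rot_sub_rot_le' (φ ψ : ℝ) (v w : Plane) :
    ‖rot φ v - rot ψ w‖ ≤ ‖v - w‖ + ‖w‖ * |φ - ψ| := by
  have h : rot φ v - rot ψ w = rot φ (v - w) + (rot φ w - rot ψ w) := by
    rw [rot_sub]; abel
  rw [h]
  refine (norm_add_le _ _).trans ?_
  rw [norm_rot]
  gcongr
  exact norm_rot_sub_rot_le φ ψ w

theorem hasDerivWithinAt_rot {φ : ℝ → ℝ} {φ' t : ℝ} {s : Set ℝ} (w : Plane)
    (h : HasDerivWithinAt φ φ' s t) :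
    HasDerivWithinAt (fun τ => rot (φ τ) w) (-(φ' • perp (rot (φ t) w))) s t := by
  have := (hasDerivAt_rot (φ t) w).scomp_hasDerivWithinAt t h
  exact this.congr_deriv (smul_neg _ _)

/-! ### Ordinary differential equations with bounded Lipschitz right-hand side -/

section ODE

variable {E : Type*} [NormedAddCommGroup E] [NormedSpace ℝ E]

/-- For a bounded, globally Lipschitz vector field the Cauchy problem with data at any
time `t₀ ∈ [0,T]` is solvable on all of `[0,T]`. -/
theorem exists_trajectory [CompleteSpace E] {v : ℝ → E → E} {K L : NNReal} {T : ℝ}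
    (hv : ∀ t, LipschitzWith K (v t)) (hc : ∀ x, ContinuousOn (fun t => v t x) (Set.Icc 0 T))
    (hb : ∀ t ∈ Set.Icc 0 T, ∀ x, ‖v t x‖ ≤ L) {t₀ : ℝ} (ht₀ : t₀ ∈ Set.Icc 0 T) (x₀ : E) :
    ∃ f : ℝ → E, f t₀ = x₀ ∧
      ∀ t ∈ Set.Icc 0 T, HasDerivWithinAt f (v t (f t)) (Set.Icc 0 T) t := by
  have hT : 0 ≤ T := ht₀.1.trans ht₀.2
  have h : IsPicardLindelof v (tmin := 0) (tmax := T) ⟨t₀, ht₀⟩ x₀ (L * T.toNNReal) 0 L K :=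
    { lipschitzOnWith := fun t _ => (hv t).lipschitzOnWith
      continuousOn := fun x _ => hc x
      norm_le := fun t ht x _ => hb t ht x
      mul_max_le := by
        have : max (T - t₀) (t₀ - 0) ≤ T := max_le (by linarith [ht₀.1]) (by linarith [ht₀.2])
        rw [NNReal.coe_zero, NNReal.coe_mul, Real.coe_toNNReal T hT]
        have h : (L : ℝ) * max (T - t₀) (t₀ - 0) ≤ L * T := mul_le_mul_of_nonneg_left this L.2
        simpa only [sub_zero] using h }
  exact h.exists_eq_forall_mem_Icc_hasDerivWithinAt₀

theorem dist_trajectories_le_right {v : ℝ → E → E} {K : NNReal} {T : ℝ}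
    (hv : ∀ t, LipschitzWith K (v t)) {f g : ℝ → E}
    (hf : ∀ t ∈ Set.Icc 0 T, HasDerivWithinAt f (v t (f t)) (Set.Icc 0 T) t)
    (hg : ∀ t ∈ Set.Icc 0 T, HasDerivWithinAt g (v t (g t)) (Set.Icc 0 T) t)
    {s t : ℝ} (hs : 0 ≤ s) (hst : s ≤ t) (ht : t ≤ T) :
    dist (f t) (g t) ≤ dist (f s) (g s) * Real.exp (K * (t - s)) := by
  have key : ∀ f : ℝ → E,
      (∀ t ∈ Set.Icc 0 T, HasDerivWithinAt f (v t (f t)) (Set.Icc 0 T) t) →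
      ContinuousOn f (Set.Icc s t) ∧
        ∀ τ ∈ Set.Ico s t, HasDerivWithinAt f (v τ (f τ)) (Set.Ici τ) τ := fun f hf =>
    ⟨fun τ hτ => ((hf τ ⟨hs.trans hτ.1, hτ.2.trans ht⟩).mono
        (Set.Icc_subset_Icc hs ht)).continuousWithinAt,
      fun τ hτ => (hf τ ⟨hs.trans hτ.1, hτ.2.le.trans ht⟩).mono_of_mem_nhdsWithin
        (mem_of_superset (Icc_mem_nhdsGE (hτ.2.trans_le ht))
          (Set.Icc_subset_Icc (hs.trans hτ.1) le_rfl))⟩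
  exact dist_le_of_trajectories_ODE hv (key f hf).1 (key f hf).2 (key g hg).1 (key g hg).2 le_rfl t
    ⟨hst, le_rfl⟩

/-- Grönwall's inequality, forwards and backwards in time. -/
theorem dist_trajectories_le {v : ℝ → E → E} {K : NNReal} {T : ℝ}
    (hv : ∀ t, LipschitzWith K (v t)) {f g : ℝ → E}
    (hf : ∀ t ∈ Set.Icc 0 T, HasDerivWithinAt f (v t (f t)) (Set.Icc 0 T) t)
    (hg : ∀ t ∈ Set.Icc 0 T, HasDerivWithinAt g (v t (g t)) (Set.Icc 0 T) t)
    {s t : ℝ} (hs : s ∈ Set.Icc 0 T) (ht : t ∈ Set.Icc 0 T) :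
    dist (f t) (g t) ≤ dist (f s) (g s) * Real.exp (K * T) := by
  rcases le_total s t with hst | hst
  · refine (dist_trajectories_le_right hv hf hg hs.1 hst ht.2).trans ?_
    gcongr
    linarith [hs.1, ht.2]
  · -- reverse time
    have key : ∀ f : ℝ → E,
        (∀ t ∈ Set.Icc 0 T, HasDerivWithinAt f (v t (f t)) (Set.Icc 0 T) t) →
        ∀ τ ∈ Set.Icc 0 T, HasDerivWithinAt (fun τ => f (T - τ)) (-v (T - τ) (f (T - τ)))
          (Set.Icc 0 T) τ := by
      intro f hf τ hτ
      have h1 : HasDerivWithinAt (fun τ : ℝ => T - τ) (-1) (Set.Icc 0 T) τ :=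
        (hasDerivWithinAt_id τ _).const_sub T
      have h2 := (hf (T - τ) ⟨by linarith [hτ.2], by linarith [hτ.1]⟩).scomp τ h1
        (fun σ hσ => ⟨by linarith [hσ.2], by linarith [hσ.1]⟩)
      exact h2.congr_deriv (by simp)
    have hv' : ∀ τ, LipschitzWith K (fun x => -v (T - τ) x) := fun τ => (hv (T - τ)).neg
    have h := dist_trajectories_le_right hv' (key f hf) (key g hg) (s := T - s) (t := T - t)
      (by linarith [hs.2]) (by linarith) (by linarith [ht.1])
    simp only [sub_sub_cancel] at h
    refine h.trans ?_
    gcongr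
    linarith [hs.2, ht.1]

theorem eqOn_trajectories {v : ℝ → E → E} {K : NNReal} {T : ℝ}
    (hv : ∀ t, LipschitzWith K (v t)) {f g : ℝ → E}
    (hf : ∀ t ∈ Set.Icc 0 T, HasDerivWithinAt f (v t (f t)) (Set.Icc 0 T) t)
    (hg : ∀ t ∈ Set.Icc 0 T, HasDerivWithinAt g (v t (g t)) (Set.Icc 0 T) t)
    {s : ℝ} (hs : s ∈ Set.Icc 0 T) (hfg : f s = g s) : Set.EqOn f g (Set.Icc 0 T) := by
  intro t ht
  have h := dist_trajectories_le hv hf hg hs ht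
  rw [hfg, dist_self, zero_mul] at h
  exact dist_le_zero.1 h

/-- The mean value inequality on `[0,T]`. -/
theorem norm_sub_zero_le_of_hasDerivWithinAt {f f' : ℝ → E} {C T t : ℝ}
    (hf : ∀ t ∈ Set.Icc 0 T, HasDerivWithinAt f (f' t) (Set.Icc 0 T) t)
    (hC : ∀ t ∈ Set.Icc 0 T, ‖f' t‖ ≤ C) (ht : t ∈ Set.Icc 0 T) : ‖f t - f 0‖ ≤ C * t := by
  simpa using norm_image_sub_le_of_norm_deriv_le_segment' hf
    (fun x hx => hC x ⟨hx.1, hx.2.le⟩) t ht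

theorem norm_sub_le_of_hasDerivWithinAt {f f' : ℝ → E} {C T s t : ℝ}
    (hf : ∀ t ∈ Set.Icc 0 T, HasDerivWithinAt f (f' t) (Set.Icc 0 T) t)
    (hC : ∀ t ∈ Set.Icc 0 T, ‖f' t‖ ≤ C) (hs : s ∈ Set.Icc 0 T) (ht : t ∈ Set.Icc 0 T) :
    ‖f t - f s‖ ≤ C * |t - s| :=
  (convex_Icc 0 T).norm_image_sub_le_of_norm_hasDerivWithin_le hf hC hs ht

end ODE

/-! ### Weak derivatives and Lipschitz functions -/

section Sobolev

variable {F : Type} [NormedAddCommGroup F] [NormedSpace ℝ F]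

theorem locallyIntegrable_of_ae_bound {E : Type*} [NormedAddCommGroup E] {f : Plane → E} {C : ℝ}
    (hf : AEStronglyMeasurable f volume) (hC : ∀ᵐ x, ‖f x‖ ≤ C) : LocallyIntegrable f volume :=
  (memLp_top_of_bound hf C hC).locallyIntegrable le_top

theorem integrable_smul_of_ae_bound {f : Plane → F} {C : ℝ} {φ : Plane → ℝ}
    (hf : AEStronglyMeasurable f volume) (hC : ∀ᵐ x, ‖f x‖ ≤ C) (hφ : Continuous φ)
    (hc : HasCompactSupport φ) : Integrable (fun x => φ x • f x) :=
  (hφ.integrable_of_hasCompactSupport hc).smul_bdd C hf hC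

/-- The mollification of a bounded function with weak gradient bounded by `C` is
`C`-Lipschitz, since its derivative is the mollified gradient. -/
theorem lipschitzWith_convolution_of_hasWeakFDeriv [CompleteSpace F] {f : Plane → F}
    {G : Plane → Plane →L[ℝ] F} {C : NNReal} (hf : LocallyIntegrable f volume)
    (hw : HasWeakFDeriv f G) (hGC : ∀ᵐ x, ‖G x‖ ≤ C)
    (φ : ContDiffBump (0 : Plane)) :
    LipschitzWith C (convolution f (φ.normed volume) (ContinuousLinearMap.lsmul ℝ ℝ).flip
      volume) := by
  have hd := fun x => (φ.hasCompactSupport_normed (μ := volume)).hasFDerivAt_convolution_right (μ := volume)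
    (ContinuousLinearMap.lsmul ℝ ℝ (E := F)).flip hf (φ.contDiff_normed (n := 1)) x
  refine lipschitzWith_of_nnnorm_fderiv_le (fun x => (hd x).differentiableAt) fun x => ?_
  rw [(hd x).fderiv]
  rw [← NNReal.coe_le_coe, coe_nnnorm]
  refine ContinuousLinearMap.opNorm_le_bound _ C.2 fun v => ?_
  rw [convolution_precompR_apply _ hf (φ.hasCompactSupport_normed.fderiv ℝ)
    ((φ.contDiff_normed (n := 1)).continuous_fderiv one_ne_zero)]
  set ψ : Plane → ℝ := fun y => φ.normed volume (x - y) with hψ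
  have hψs : ContDiff ℝ ∞ ψ := φ.contDiff_normed.comp (contDiff_const.sub contDiff_id)
  have hψc : HasCompactSupport ψ :=
    φ.hasCompactSupport_normed.comp_homeomorph (Homeomorph.subLeft x)
  have hψd : ∀ y, fderiv ℝ ψ y v = - fderiv ℝ (φ.normed volume) (x - y) v := by
    intro y
    have h1 : HasFDerivAt (φ.normed volume) (fderiv ℝ (φ.normed volume) (x - y)) (x - y) :=
      ((φ.contDiff_normed (n := 1)).differentiable one_ne_zero _).hasFDerivAt
    have h2 := h1.comp y ((hasFDerivAt_id y).const_sub x)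
    rw [HasFDerivAt.fderiv (f := ψ) h2]
    simp
  have h := hw ψ hψs hψc v
  simp only [hψd, neg_smul, integral_neg, neg_inj] at h
  have hconv : convolution f (fun a => fderiv ℝ (φ.normed volume) a v)
      (ContinuousLinearMap.lsmul ℝ ℝ).flip volume x = ∫ y, ψ y • G y v := by
    rw [← h]; simp [convolution]
  rw [hconv]
  have hint : Integrable ψ := hψs.continuous.integrable_of_hasCompactSupport hψc
  calc ‖∫ y, ψ y • G y v‖ ≤ ∫ y, ψ y * (C * ‖v‖) := by
        refine norm_integral_le_of_norm_le (hint.mul_const _) ?_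
        filter_upwards [hGC] with y hy
        rw [norm_smul, Real.norm_of_nonneg (φ.nonneg_normed _)]
        exact mul_le_mul_of_nonneg_left ((G y).le_of_opNorm_le hy v) (φ.nonneg_normed _)
    _ = C * ‖v‖ := by
        rw [integral_mul_const, integral_sub_left_eq_self (φ.normed volume) volume x,
          φ.integral_normed, one_mul]

/-- A bounded function with bounded weak gradient has a Lipschitz representative. -/
theorem exists_lipschitzWith_of_hasWeakFDeriv [FiniteDimensional ℝ F] {f : Plane → F}
    {G : Plane → Plane →L[ℝ] F} {C : ℝ} (hf : AEStronglyMeasurable f volume)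
    (hC : ∀ᵐ x, ‖f x‖ ≤ C) (hw : HasWeakFDeriv f G) (hGC : ∀ᵐ x, ‖G x‖ ≤ C) :
    ∃ (K : NNReal) (g : Plane → F), LipschitzWith K g ∧ f =ᵐ[volume] g := by
  have : CompleteSpace F := FiniteDimensional.complete ℝ F
  have hfl := locallyIntegrable_of_ae_bound hf hC
  let φ : ℕ → ContDiffBump (0 : Plane) := fun n =>
    ⟨1 / ((n : ℝ) + 1), 2 * (1 / ((n : ℝ) + 1)), by positivity,
      lt_mul_of_one_lt_left (by positivity) one_lt_two⟩
  have hφ : Tendsto (fun n => (φ n).rOut) atTop (𝓝 0) := by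
    simpa [φ] using tendsto_one_div_add_atTop_nhds_zero_nat.const_mul (2 : ℝ)
  have hlim := ContDiffBump.ae_convolution_tendsto_right_of_locallyIntegrable (K := 2) hφ
    (Eventually.of_forall fun n => le_rfl) hfl
  simp_rw [← convolution_flip (L := ContinuousLinearMap.lsmul ℝ ℝ)] at hlim
  have hGC' : ∀ᵐ x, ‖G x‖ ≤ C.toNNReal := by
    filter_upwards [hGC] with x hx using hx.trans (Real.le_coe_toNNReal C)
  have hlip : LipschitzOnWith C.toNNReal f {x | Tendsto (fun n => convolution f
      ((φ n).normed volume) (ContinuousLinearMap.lsmul ℝ ℝ).flip volume x) atTop (𝓝 (f x))} := by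
    refine LipschitzOnWith.of_dist_le_mul fun x hx y hy => ?_
    exact le_of_tendsto (hx.dist hy) (Eventually.of_forall fun n =>
      (lipschitzWith_convolution_of_hasWeakFDeriv hfl hw hGC' (φ n)).dist_le_mul x y)
  obtain ⟨g, hg, hfg⟩ := hlip.extend_finite_dimension
  exact ⟨_, g, hg, by filter_upwards [hlim] with x hx using hfg hx⟩

/-- The weak gradient of a differentiable function is its gradient. -/
theorem ae_eq_fderiv_of_hasWeakFDeriv [FiniteDimensional ℝ F] {f : Plane → F}
    {G : Plane → Plane →L[ℝ] F} {C : ℝ} (hf : ContDiff ℝ 1 f) (hw : HasWeakFDeriv f G)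
    (hG : AEStronglyMeasurable G volume) (hGC : ∀ᵐ x, ‖G x‖ ≤ C) : G =ᵐ[volume] fderiv ℝ f := by
  have : CompleteSpace F := FiniteDimensional.complete ℝ F
  have hf' := hf.continuous_fderiv one_ne_zero
  refine ae_eq_of_integral_contDiff_smul_eq (locallyIntegrable_of_ae_bound hG hGC)
    hf'.locallyIntegrable fun φ hφ hc => ?_
  have hd : Continuous (fderiv ℝ φ) := hφ.continuous_fderiv (by simp)
  have i1 := integrable_smul_of_ae_bound hG hGC hφ.continuous hc
  have i2 : Integrable (fun x => φ x • fderiv ℝ f x) :=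
    (hφ.continuous.smul hf').integrable_of_hasCompactSupport hc.smul_right
  ext1 v
  rw [ContinuousLinearMap.integral_apply i1, ContinuousLinearMap.integral_apply i2]
  have h := integral_smul_fderiv_eq_neg_fderiv_smul_of_integrable (μ := (volume : Measure Plane))
    (f := φ) (g := f) (v := v)
    (((hd.clm_apply continuous_const).smul hf.continuous).integrable_of_hasCompactSupport
      ((hc.fderiv_apply ℝ v).smul_right))
    ((hφ.continuous.smul (hf'.clm_apply continuous_const)).integrable_of_hasCompactSupport
      hc.smul_right)
    ((hφ.continuous.smul hf.continuous).integrable_of_hasCompactSupport hc.smul_right)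
    (fun x _ => hφ.differentiable (by simp) x) (fun x _ => hf.differentiable one_ne_zero x)
  rw [hw φ hφ hc v, neg_neg] at h
  simpa using h.symm

theorem Continuous.norm_le_of_ae {E : Type*} [NormedAddCommGroup E] {f : Plane → E}
    (hf : Continuous f) {C : ℝ}
    (h : ∀ᵐ x, ‖f x‖ ≤ C) (x : Plane) : ‖f x‖ ≤ C := by
  have hcl : IsClosed {x | ‖f x‖ ≤ C} := isClosed_le hf.norm continuous_const
  have hx := (Measure.dense_of_ae h).closure_eq ▸ Set.mem_univ x
  rwa [hcl.closure_eq] at hx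

theorem WInfBound.aestronglyMeasurable {k : ℕ} {σ C : ℝ} {f : Plane → F}
    (h : WInfBound k σ F f C) : AEStronglyMeasurable f volume := by
  cases k <;> exact h.1

theorem WInfBound.ae_bound {k : ℕ} {σ C : ℝ} {f : Plane → F}
    (h : WInfBound k σ F f C) : ∀ᵐ x, ‖f x‖ ≤ C := by
  cases k <;> exact h.2.1

theorem MemSobolevInf.exists_lipschitzWith [FiniteDimensional ℝ F] {s : ℝ} {f : Plane → F}
    (hs : 1 ≤ s) (h : MemSobolevInf s f) :
    ∃ (K : NNReal) (g : Plane → F), LipschitzWith K g ∧ f =ᵐ[volume] g := by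
  obtain ⟨C, hC⟩ := h
  unfold SobolevInfBound at hC
  obtain ⟨k, hk⟩ : ∃ k, ⌊s⌋₊ = k + 1 := Nat.exists_eq_add_one.2 (Nat.floor_pos.2 hs)
  generalize s - (⌊s⌋₊ : ℝ) = σ at hC
  rw [hk] at hC
  obtain ⟨hm, hb, G, hw, hG⟩ := hC
  exact exists_lipschitzWith_of_hasWeakFDeriv hm hb hw hG.ae_bound

theorem MemSobolevInf.ae_bound {s : ℝ} {f : Plane → F} (h : MemSobolevInf s f) :
    ∃ C, ∀ᵐ x, ‖f x‖ ≤ C := h.imp fun _ hC => WInfBound.ae_bound hC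

end Sobolev

/-- The bounds on the magnetic field: `m ≤ b`, and `b`, its gradient and the Lipschitz
constant of its gradient are at most `L`. -/
structure FieldBounds (b : Plane → ℝ) (m L : ℝ) : Prop where
  pos : 0 < m
  le : ∀ x, m ≤ b x
  le_upper : ∀ x, b x ≤ L
  differentiable : Differentiable ℝ b
  norm_fderiv_le : ∀ x, ‖fderiv ℝ b x‖ ≤ L
  norm_fderiv_sub_le : ∀ x y, ‖fderiv ℝ b x - fderiv ℝ b y‖ ≤ L * ‖x - y‖

theorem exists_fieldBounds {b : Plane → ℝ} (hb : ContDiff ℝ ∞ b) (hs : MemSobolevInf 2 b)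
    {m : ℝ} (hm : 0 < m) (hmb : ∀ x, m ≤ b x) : ∃ L, FieldBounds b m L := by
  obtain ⟨C, hC⟩ := hs
  have h2 : ⌊(2 : ℝ)⌋₊ = 2 := Nat.floor_ofNat 2
  unfold SobolevInfBound at hC
  rw [h2] at hC
  obtain ⟨hbm, hbC, G, hw, hGm, hGC, H, hwG, hH⟩ := hC
  obtain ⟨K, g, hg, hbg⟩ := exists_lipschitzWith_of_hasWeakFDeriv hbm hbC hw hGC
  obtain ⟨K', g', hg', hGg'⟩ := exists_lipschitzWith_of_hasWeakFDeriv hGm hGC hwG hH.ae_bound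
  have e1 : b = g := (hb.continuous.ae_eq_iff_eq volume hg.continuous).1 hbg
  have hb' : Continuous (fderiv ℝ b) := hb.continuous_fderiv (by simp)
  have e2 : fderiv ℝ b = g' := (hb'.ae_eq_iff_eq volume hg'.continuous).1
    ((ae_eq_fderiv_of_hasWeakFDeriv (hb.of_le (by exact_mod_cast le_top)) hw hGm hGC).symm.trans
      hGg')
  have hbd : ∀ x, b x ≤ C := fun x =>
    (le_abs_self _).trans (hb.continuous.norm_le_of_ae hbC x)
  refine ⟨max C (max K K'), hm, hmb, fun x => (hbd x).trans (le_max_left _ _),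
    hb.differentiable (by simp), fun x => ?_, fun x y => ?_⟩
  · rw [← e1] at hg
    exact (norm_fderiv_le_of_lipschitz ℝ hg).trans ((le_max_left _ _).trans (le_max_right _ _))
  · rw [← e2] at hg'
    refine (hg'.norm_sub_le x y).trans ?_
    gcongr
    exact (le_max_right _ _).trans (le_max_right _ _)

theorem LipschitzWith.hasWeakFDeriv {u : Plane → Plane} {K : NNReal} (hu : LipschitzWith K u) :
    HasWeakFDeriv u (fderiv ℝ u) := by
  intro φ hφ hc v
  have hu' : AEStronglyMeasurable (fun x => fderiv ℝ u x v) volume :=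
    (measurable_fderiv_apply_const ℝ u v).aestronglyMeasurable
  have hd : Continuous (fderiv ℝ φ) := hφ.continuous_fderiv (by simp)
  have i1 : Integrable (fun x => fderiv ℝ φ x v • u x) :=
    ((hd.clm_apply continuous_const).smul hu.continuous).integrable_of_hasCompactSupport
      ((hc.fderiv_apply ℝ v).smul_right)
  have i2 : Integrable (fun x => φ x • fderiv ℝ u x v) :=
    integrable_smul_of_ae_bound hu' (C := K * ‖v‖) (Eventually.of_forall fun x =>
      (fderiv ℝ u x).le_of_opNorm_le (norm_fderiv_le_of_lipschitz ℝ hu) v) hφ.continuous hc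
  obtain ⟨D, hD⟩ := (hφ.of_le (m := 1) (by exact_mod_cast le_top)).lipschitzWith_of_hasCompactSupport
    hc one_ne_zero
  ext i
  have p1 := (EuclideanSpace.proj i : Plane →L[ℝ] ℝ).integral_comp_comm i1
  have p2 := (EuclideanSpace.proj i : Plane →L[ℝ] ℝ).integral_comp_comm i2
  simp only [PiLp.proj_apply] at p1 p2
  rw [PiLp.neg_apply, ← p1, ← p2]
  have hui : LipschitzWith (1 * K) (fun x => u x i) := by
    refine LipschitzWith.comp (g := u) (f := fun y : Plane => y i) ?_ hu
    exact LipschitzWith.of_dist_le_mul fun x y => by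
      rw [NNReal.coe_one, one_mul, dist_eq_norm, dist_eq_norm]
      exact PiLp.norm_apply_le (x - y) i
  have h := hui.integral_lineDeriv_mul_eq (μ := volume) hD hc v
  rw [← integral_neg]
  have e1 : ∀ x, (fderiv ℝ φ x v • u x) i = -(lineDeriv ℝ φ x (-v) * u x i) := by
    intro x
    rw [(hφ.differentiable (by simp) x).lineDeriv_eq_fderiv]
    simp
  have e2 : ∀ᵐ x, -(φ x • fderiv ℝ u x v) i = -(lineDeriv ℝ (fun x => u x i) x v * φ x) := by
    filter_upwards [hu.ae_differentiableAt] with x hx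
    have := ((EuclideanSpace.proj i : Plane →L[ℝ] ℝ).hasFDerivAt.comp x
      hx.hasFDerivAt).hasLineDerivAt v
    have h3 : lineDeriv ℝ (fun x => u x i) x v = fderiv ℝ u x v i := this.lineDeriv
    rw [h3]
    simp [mul_comm]
  rw [integral_congr_ae e2, integral_congr_ae (Eventually.of_forall e1), integral_neg, integral_neg,
    h]

theorem LipschitzWith.sobolevInfBound_one {u : Plane → Plane} {K : NNReal} {R : ℝ}
    (hu : LipschitzWith K u) (hR : ∀ x, ‖u x‖ ≤ R) : SobolevInfBound 1 u (R + 2 * K) := by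
  have hK : ∀ x, ‖fderiv ℝ u x‖ ≤ K := fun x => norm_fderiv_le_of_lipschitz ℝ hu
  have hR0 : 0 ≤ R := (norm_nonneg _).trans (hR 0)
  have hm : AEStronglyMeasurable (fderiv ℝ u) volume :=
    (measurable_fderiv ℝ u).aestronglyMeasurable
  unfold SobolevInfBound
  rw [Nat.floor_one, Nat.cast_one, sub_self]
  refine ⟨hu.continuous.aestronglyMeasurable, Eventually.of_forall fun x => ?_, fderiv ℝ u,
    hu.hasWeakFDeriv, hm, Eventually.of_forall fun x => ?_, Eventually.of_forall fun p => ?_⟩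
  · linarith [hR x, K.2]
  · linarith [hK x, K.2]
  · rw [Real.rpow_zero, mul_one]
    linarith [_root_.norm_sub_le (fderiv ℝ u p.1) (fderiv ℝ u p.2), hK p.1, hK p.2]

/-! ### Characteristics and their drift -/

/-- The gradient of `log b`, as a linear form. -/
noncomputable def logFDeriv (b : Plane → ℝ) (x : Plane) : Plane →L[ℝ] ℝ :=
  (b x)⁻¹ • fderiv ℝ b x

namespace FieldBounds

variable {b : Plane → ℝ} {m L : ℝ}

theorem pos_at (h : FieldBounds b m L) (x : Plane) : 0 < b x := h.pos.trans_le (h.le x)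

theorem pos_upper (h : FieldBounds b m L) : 0 < L := (h.pos_at 0).trans_le (h.le_upper 0)

theorem inv_le (h : FieldBounds b m L) (x : Plane) : (b x)⁻¹ ≤ m⁻¹ := inv_anti₀ h.pos (h.le x)

theorem abs_sub_le (h : FieldBounds b m L) (x y : Plane) : |b x - b y| ≤ L * ‖x - y‖ := by
  simpa using convex_univ.norm_image_sub_le_of_norm_fderiv_le (𝕜 := ℝ)
    (fun z _ => h.differentiable z) (fun z _ => h.norm_fderiv_le z) (Set.mem_univ y)
    (Set.mem_univ x)

theorem lipschitzWith (h : FieldBounds b m L) : LipschitzWith L.toNNReal b :=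
  LipschitzWith.of_dist_le_mul fun x y => by
    rw [Real.coe_toNNReal L h.pos_upper.le, Real.dist_eq, dist_eq_norm]; exact h.abs_sub_le x y

theorem abs_taylor_le (h : FieldBounds b m L) (x y : Plane) :
    |b y - b x - fderiv ℝ b x (y - x)| ≤ L * ‖y - x‖ ^ 2 := by
  have := (convex_closedBall x ‖y - x‖).norm_image_sub_le_of_norm_hasFDerivWithin_le'
    (f := b) (f' := fderiv ℝ b) (φ := fderiv ℝ b x) (C := L * ‖y - x‖) (x := x) (y := y)
    (fun z _ => (h.differentiable z).hasFDerivAt.hasFDerivWithinAt)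
    (fun z hz => (h.norm_fderiv_sub_le z x).trans
      (mul_le_mul_of_nonneg_left (by simpa [dist_eq_norm] using hz) h.pos_upper.le))
    (by simp) (by simp [dist_eq_norm])
  rw [Real.norm_eq_abs] at this
  linarith

theorem abs_second_difference_le (h : FieldBounds b m L) (k x y : Plane) :
    |(b (x + k) - b x) - (b (y + k) - b y)| ≤ L * ‖k‖ * ‖x - y‖ := by
  have hd : ∀ z, HasFDerivAt (fun z => b (z + k) - b z) (fderiv ℝ b (z + k) - fderiv ℝ b z) z :=
    fun z => ((hasFDerivAt_comp_add_right k).2 (h.differentiable (z + k)).hasFDerivAt).sub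
      (h.differentiable z).hasFDerivAt
  have hb : ∀ z, ‖fderiv ℝ b (z + k) - fderiv ℝ b z‖ ≤ L * ‖k‖ := fun z => by
    simpa using h.norm_fderiv_sub_le (z + k) z
  simpa using convex_univ.norm_image_sub_le_of_norm_hasFDerivWithin_le (𝕜 := ℝ)
    (fun z _ => (hd z).hasFDerivWithinAt) (fun z _ => hb z) (Set.mem_univ y) (Set.mem_univ x)

theorem abs_inv_sub_inv_le (h : FieldBounds b m L) (x y : Plane) :
    |(b x)⁻¹ - (b y)⁻¹| ≤ m⁻¹ * m⁻¹ * L * ‖x - y‖ := by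
  have h1 : (b x)⁻¹ - (b y)⁻¹ = (b x)⁻¹ * (b y)⁻¹ * (b y - b x) := by
    field_simp [(h.pos_at x).ne', (h.pos_at y).ne']
  have hx := inv_nonneg.2 (h.pos_at x).le
  have hy := inv_nonneg.2 (h.pos_at y).le
  have hm := inv_nonneg.2 h.pos.le
  rw [h1, abs_mul, abs_of_nonneg (mul_nonneg hx hy), abs_sub_comm, mul_assoc _ L]
  exact mul_le_mul (mul_le_mul (h.inv_le x) (h.inv_le y) hy hm) (h.abs_sub_le x y) (abs_nonneg _)
    (mul_nonneg hm hm)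

theorem norm_logFDeriv_le (h : FieldBounds b m L) (x : Plane) :
    ‖logFDeriv b x‖ ≤ m⁻¹ * L := by
  rw [logFDeriv, norm_smul, Real.norm_of_nonneg (inv_nonneg.2 (h.pos_at x).le)]
  exact mul_le_mul (h.inv_le x) (h.norm_fderiv_le x) (norm_nonneg _) (inv_nonneg.2 h.pos.le)

theorem norm_logFDeriv_sub_le (h : FieldBounds b m L) (x y : Plane) :
    ‖logFDeriv b x - logFDeriv b y‖ ≤ (m⁻¹ * L + m⁻¹ * m⁻¹ * L * L) * ‖x - y‖ := by
  have e : logFDeriv b x - logFDeriv b y = (b x)⁻¹ • (fderiv ℝ b x - fderiv ℝ b y)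
      + ((b x)⁻¹ - (b y)⁻¹) • fderiv ℝ b y := by
    simp only [logFDeriv]; module
  have hm := inv_nonneg.2 h.pos.le
  have h1 : ‖(b x)⁻¹ • (fderiv ℝ b x - fderiv ℝ b y)‖ ≤ m⁻¹ * (L * ‖x - y‖) := by
    rw [norm_smul, Real.norm_of_nonneg (inv_nonneg.2 (h.pos_at x).le)]
    exact mul_le_mul (h.inv_le x) (h.norm_fderiv_sub_le x y) (norm_nonneg _) hm
  have h2 : ‖((b x)⁻¹ - (b y)⁻¹) • fderiv ℝ b y‖ ≤ m⁻¹ * m⁻¹ * L * ‖x - y‖ * L := by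
    rw [norm_smul, Real.norm_eq_abs]
    exact mul_le_mul (h.abs_inv_sub_inv_le x y) (h.norm_fderiv_le y) (norm_nonneg _)
      ((abs_nonneg _).trans (h.abs_inv_sub_inv_le x y))
  rw [e]
  linarith [norm_add_le ((b x)⁻¹ • (fderiv ℝ b x - fderiv ℝ b y))
    (((b x)⁻¹ - (b y)⁻¹) • fderiv ℝ b y)]

end FieldBounds

/-- `X` is the characteristic issued from `x` with initial velocity `w` on `[0,T]`. Since the
speed is conserved, the velocity is `w` rotated by a phase `φ`, which accumulates at the rate
`b(X)/ε`; the pair `(X, φ)` then solves a system with bounded Lipschitz right-hand side. -/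
structure IsCharacteristic (ε T : ℝ) (b : Plane → ℝ) (w x : Plane) (X : ℝ → Plane) (φ : ℝ → ℝ) :
    Prop where
  position_zero : X 0 = x
  phase_zero : φ 0 = 0
  position : ∀ t ∈ Set.Icc 0 T, HasDerivWithinAt X (rot (φ t) w) (Set.Icc 0 T) t
  phase : ∀ t ∈ Set.Icc 0 T, HasDerivWithinAt φ (b (X t) / ε) (Set.Icc 0 T) t

namespace IsCharacteristic

variable {ε T m L R : ℝ} {b : Plane → ℝ} {w x : Plane} {X : ℝ → Plane} {φ : ℝ → ℝ}

theorem velocity (c : IsCharacteristic ε T b w x X φ) {t : ℝ} (ht : t ∈ Set.Icc 0 T) :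
    HasDerivWithinAt (fun t => rot (φ t) w) (-((b (X t) / ε) • perp (rot (φ t) w)))
      (Set.Icc 0 T) t :=
  hasDerivWithinAt_rot w (c.phase t ht)

/-- The error made when the motion is replaced by gyration in the constant field `b x`. -/
noncomputable def gyrationError (ε : ℝ) (b : Plane → ℝ) (w x : Plane) (X : ℝ → Plane) (φ : ℝ → ℝ)
    (t : ℝ) : Plane := X t - x - (ε / b x) • perp (rot (φ t) w - w)

theorem gyrationError_zero (c : IsCharacteristic ε T b w x X φ) :
    gyrationError ε b w x X φ 0 = 0 := by
  simp [gyrationError, c.position_zero, c.phase_zero, ← perpL_apply]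

theorem hasDerivWithinAt_gyrationError (c : IsCharacteristic ε T b w x X φ) (hε : 0 < ε)
    (hb : 0 < b x) {t : ℝ} (ht : t ∈ Set.Icc 0 T) :
    HasDerivWithinAt (gyrationError ε b w x X φ) ((-((b (X t) - b x) / b x)) • rot (φ t) w)
      (Set.Icc 0 T) t := by
  have h1 := perpL.hasFDerivAt.comp_hasDerivWithinAt t ((c.velocity ht).sub_const w)
  have h2 := ((c.position t ht).sub_const x).sub (h1.const_smul (ε / b x))
  refine HasDerivWithinAt.congr_deriv (f := gyrationError ε b w x X φ) h2 ?_
  have e' : perpL (-((b (X t) / ε) • perp (rot (φ t) w))) = (b (X t) / ε) • rot (φ t) w := by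
    rw [map_neg, map_smul, perpL_apply, perp_perp, smul_neg, neg_neg]
  rw [e', smul_smul, ← sub_eq_zero]
  have e : ε / b x * (b (X t) / ε) = b (X t) / b x := by field_simp
  rw [e, sub_div, div_self hb.ne']
  module

theorem norm_gyration_le (hε : 0 < ε) (hf : FieldBounds b m L) (hw : ‖w‖ ≤ R) (t : ℝ) :
    ‖(ε / b x) • perp (rot (φ t) w - w)‖ ≤ 2 * R * m⁻¹ * ε := by
  rw [norm_smul, norm_perp, Real.norm_of_nonneg (div_nonneg hε.le (hf.pos_at x).le)]
  have h1 : ‖rot (φ t) w - w‖ ≤ 2 * R := by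
    linarith [norm_sub_le (rot (φ t) w) w, norm_rot (φ t) w]
  have h2 : ε / b x ≤ ε * m⁻¹ := by
    rw [div_eq_mul_inv]; exact mul_le_mul_of_nonneg_left (hf.inv_le x) hε.le
  have h3 : 0 ≤ ε * m⁻¹ := mul_nonneg hε.le (inv_nonneg.2 hf.pos.le)
  calc _ ≤ ε * m⁻¹ * (2 * R) := mul_le_mul h2 h1 (norm_nonneg _) h3
    _ = _ := by ring

/-- Particles stay within a distance `O(ε)` of their initial position. -/
theorem norm_position_sub_le (c : IsCharacteristic ε T b w x X φ) (hε : 0 < ε)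
    (hf : FieldBounds b m L) (hR : 0 < R) (hw : ‖w‖ ≤ R) {t : ℝ} (ht : t ∈ Set.Icc 0 T) :
    ‖X t - x‖ ≤ 2 * R * m⁻¹ * Real.exp (L * m⁻¹ * R * T) * ε := by
  set Z := gyrationError ε b w x X φ with hZ
  have hm : 0 < m⁻¹ := inv_pos.2 hf.pos
  have hL := hf.pos_upper
  have hXZ : ∀ t, ‖X t - x‖ ≤ ‖Z t‖ + 2 * R * m⁻¹ * ε := by
    intro t
    have e : X t - x = Z t + (ε / b x) • perp (rot (φ t) w - w) := by
      simp [hZ, gyrationError]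
    rw [e]
    exact (norm_add_le _ _).trans (add_le_add le_rfl (norm_gyration_le hε hf hw t))
  have hder := fun t ht => c.hasDerivWithinAt_gyrationError hε (hf.pos_at x) (t := t) ht
  have hK : L * m⁻¹ * R ≠ 0 := by positivity
  have key := norm_le_gronwallBound_of_norm_deriv_right_le (f := Z)
    (f' := fun t => (-((b (X t) - b x) / b x)) • rot (φ t) w) (δ := 0) (K := L * m⁻¹ * R)
    (ε := L * m⁻¹ * R * (2 * R * m⁻¹ * ε)) (a := 0) (b := T)
    (fun t ht => (hder t ht).continuousWithinAt)
    (fun t ht => (hder t ⟨ht.1, ht.2.le⟩).mono_of_mem_nhdsWithin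
        (mem_of_superset (Icc_mem_nhdsGE ht.2) (Set.Icc_subset_Icc ht.1 le_rfl)))
    (by rw [hZ, c.gyrationError_zero, norm_zero])
    (fun t ht => by
      rw [norm_smul, norm_rot, Real.norm_eq_abs, abs_neg, abs_div, abs_of_pos (hf.pos_at x),
        div_eq_mul_inv, ← mul_add]
      have h1 : |b (X t) - b x| * (b x)⁻¹ ≤ L * (‖Z t‖ + 2 * R * m⁻¹ * ε) * m⁻¹ := by
        refine mul_le_mul ((hf.abs_sub_le _ _).trans ?_) (hf.inv_le x)
          (inv_nonneg.2 (hf.pos_at x).le) (by positivity)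
        exact mul_le_mul_of_nonneg_left (hXZ t) hL.le
      calc _ ≤ L * (‖Z t‖ + 2 * R * m⁻¹ * ε) * m⁻¹ * R :=
            mul_le_mul h1 hw (norm_nonneg _) (by positivity)
        _ = _ := by ring) t ht
  simp only [gronwallBound_of_K_ne_0 hK] at key
  rw [zero_mul, zero_add, sub_zero, mul_div_cancel_left₀ _ hK] at key
  have hexp : Real.exp (L * m⁻¹ * R * t) ≤ Real.exp (L * m⁻¹ * R * T) := by
    gcongr; exact ht.2
  have := mul_le_mul_of_nonneg_left hexp (show 0 ≤ 2 * R * m⁻¹ * ε by positivity)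
  linarith [hXZ t]

/-- The field seen by the particle, to second order in `ε`. The energy-like identity
`d/dt (∇b·Z + (∇b·(X - x))² / 2b) = O(ε²)`, with the gradient frozen at `x` and `Z` the gyration
error, shows that the drift is orthogonal to `∇b` up to `O(ε²)`. -/
theorem abs_field_sub_le (c : IsCharacteristic ε T b w x X φ) (hε : 0 < ε)
    (hf : FieldBounds b m L) (hw : ‖w‖ ≤ R) {D : ℝ} (hD : ∀ t ∈ Set.Icc 0 T, ‖X t - x‖ ≤ D * ε)
    {t : ℝ} (ht : t ∈ Set.Icc 0 T) :
    |b (X t) - b x - (ε / b x) * fderiv ℝ b x (perp (rot (φ t) w - w))| ≤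
      (L * D ^ 2 * m⁻¹ * (L * R) * T + (L * D) ^ 2 * m⁻¹ + L * D ^ 2) * ε ^ 2 := by
  have hm : 0 < m⁻¹ := inv_pos.2 hf.pos
  have hL := hf.pos_upper
  have hR : 0 ≤ R := (norm_nonneg _).trans hw
  have hb := hf.pos_at x
  set g := fderiv ℝ b x with hg
  set Z := gyrationError ε b w x X φ with hZ
  have hgn : ‖g‖ ≤ L := hf.norm_fderiv_le x
  have he : ∀ t ∈ Set.Icc 0 T, |b (X t) - b x - g (X t - x)| ≤ L * D ^ 2 * ε ^ 2 := by
    intro t ht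
    refine (hf.abs_taylor_le x (X t)).trans ?_
    rw [mul_assoc, ← mul_pow]
    have := hD t ht
    gcongr
  have hh : ∀ t ∈ Set.Icc 0 T,
      HasDerivWithinAt (fun t => g (X t - x)) (g (rot (φ t) w)) (Set.Icc 0 T) t := fun t ht =>
    g.hasFDerivAt.comp_hasDerivWithinAt t ((c.position t ht).sub_const x)
  have hQ : ∀ t ∈ Set.Icc 0 T,
      HasDerivWithinAt (fun t => g (Z t) + (g (X t - x)) ^ 2 * (2 * b x)⁻¹)
        (-((b (X t) - b x - g (X t - x)) * (b x)⁻¹ * g (rot (φ t) w))) (Set.Icc 0 T) t := by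
    intro t ht
    have h1 := g.hasFDerivAt.comp_hasDerivWithinAt t
      (c.hasDerivWithinAt_gyrationError hε hb ht)
    have h2 := ((hh t ht).pow 2).mul_const (2 * b x)⁻¹
    refine (h1.add h2).congr_deriv ?_
    rw [map_smul, smul_eq_mul]
    field_simp
    ring
  have hbound := norm_sub_zero_le_of_hasDerivWithinAt hQ
    (C := L * D ^ 2 * ε ^ 2 * m⁻¹ * (L * R)) (fun t ht => by
      rw [norm_neg, norm_mul, norm_mul, Real.norm_eq_abs,
        Real.norm_of_nonneg (inv_nonneg.2 hb.le)]
      have h1 : ‖g (rot (φ t) w)‖ ≤ L * R := by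
        refine (g.le_of_opNorm_le hgn _).trans ?_
        rw [norm_rot]; gcongr
      have h2 := he t ht
      have h3 := hf.inv_le x
      gcongr) ht
  simp only [hZ, c.gyrationError_zero, c.position_zero, sub_self, map_zero] at hbound
  rw [← hZ, Real.norm_eq_abs] at hbound
  have hq : |(g (X t - x)) ^ 2 * (2 * b x)⁻¹| ≤ (L * D) ^ 2 * m⁻¹ * ε ^ 2 := by
    have h1 : |g (X t - x)| ≤ L * (D * ε) := by
      refine (g.le_of_opNorm_le hgn _).trans ?_
      have := hD t ht
      gcongr
    have h2 : (2 * b x)⁻¹ ≤ m⁻¹ := inv_anti₀ hf.pos (by linarith [hf.le x])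
    rw [abs_mul, abs_pow, abs_of_nonneg (show (0 : ℝ) ≤ (2 * b x)⁻¹ by positivity)]
    calc _ ≤ (L * (D * ε)) ^ 2 * m⁻¹ := by gcongr
      _ = _ := by ring
  have hT : L * D ^ 2 * ε ^ 2 * m⁻¹ * (L * R) * t ≤ L * D ^ 2 * ε ^ 2 * m⁻¹ * (L * R) * T := by
    gcongr; exact ht.2
  have e : b (X t) - b x - (ε / b x) * g (perp (rot (φ t) w - w)) =
      (b (X t) - b x - g (X t - x)) + (g (Z t) + g (X t - x) ^ 2 * (2 * b x)⁻¹)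
        - g (X t - x) ^ 2 * (2 * b x)⁻¹ := by
    have : g (Z t) = g (X t - x) - (ε / b x) * g (perp (rot (φ t) w - w)) := by
      rw [hZ, gyrationError, map_sub g (X t - x), map_smul, smul_eq_mul]
    rw [this]; ring
  rw [e]
  have h0 : (0:ℝ) ^ 2 * (2 * b x)⁻¹ = 0 := by ring
  rw [h0, add_zero, sub_zero] at hbound
  refine (abs_sub _ _).trans ?_
  refine (add_le_add (abs_add_le _ _) hq).trans ?_
  linarith [he t ht]

end IsCharacteristic

/-- Asymptotics of the phase, expressed at the position reached at time `t`: it solves the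
implicit phase equation up to `O(ε)`, uniformly in all the data. -/
theorem exists_phase_bound {m L R T : ℝ} (hR : 0 < R) (hT : 0 ≤ T) :
    ∃ C, 0 ≤ C ∧ ∀ b, FieldBounds b m L → ∀ ε, 0 < ε → ∀ w x X φ, ‖w‖ ≤ R →
      IsCharacteristic ε T b w x X φ → ∀ t ∈ Set.Icc 0 T, ‖X t - x‖ ≤ C * ε ∧
        |φ t - (b (X t) * t / ε - t * logFDeriv b (X t) (perp (rot (φ t) w)))| ≤ C * ε := by
  by_cases hex : ∃ b, FieldBounds b m L
  swap
  · exact ⟨0, le_rfl, fun b hb => (hex ⟨b, hb⟩).elim⟩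
  obtain ⟨b₀, hb₀⟩ := hex
  have hm : 0 < m⁻¹ := inv_pos.2 hb₀.pos
  have hL := hb₀.pos_upper
  set D := 2 * R * m⁻¹ * Real.exp (L * m⁻¹ * R * T) with hDdef
  have hD0 : 0 ≤ D := by positivity
  set A := L * D ^ 2 * m⁻¹ * (L * R) * T + (L * D) ^ 2 * m⁻¹ + L * D ^ 2 with hA
  have hA0 : 0 ≤ A := by positivity
  set B := A * T + m⁻¹ * L * D + A * T + T * ((m⁻¹ * L + m⁻¹ * m⁻¹ * L * L) * D * R) with hB
  have hB0 : 0 ≤ B := by positivity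
  refine ⟨D + B, by positivity, fun b hf ε hε w x X φ hw c t ht => ?_⟩
  have hpos := fun t ht => c.norm_position_sub_le hε hf hR hw (t := t) ht
  refine ⟨(hpos t ht).trans (by gcongr; linarith), ?_⟩
  have hfield := fun t ht => c.abs_field_sub_le hε hf hw hpos (t := t) ht
  simp only [← hDdef, ← hA] at hpos hfield
  set g := fderiv ℝ b x with hg
  have hb := hf.pos_at x
  have hd : ∀ t ∈ Set.Icc 0 T,
      HasDerivWithinAt (fun t => ε * φ t - b x * t - (ε / b x) * g (perpL (X t - x - t • w)))
        (b (X t) - b x - (ε / b x) * g (perp (rot (φ t) w - w))) (Set.Icc 0 T) t := by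
    intro t ht
    have h1 := ((c.phase t ht).const_mul ε).sub ((hasDerivWithinAt_id t (Set.Icc 0 T)).const_mul
      (b x))
    have h2 := ((g.comp perpL).hasFDerivAt.comp_hasDerivWithinAt t
      (((c.position t ht).sub_const x).sub
        ((hasDerivWithinAt_id t (Set.Icc 0 T)).smul_const w))).const_mul (ε / b x)
    refine (h1.sub h2).congr_deriv ?_
    rw [one_smul, mul_one, mul_div_cancel₀ _ hε.ne']
    rfl
  have h1 := norm_sub_zero_le_of_hasDerivWithinAt hd (C := A * ε ^ 2) (fun t ht => hfield t ht) ht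
  simp only [c.phase_zero, c.position_zero, sub_self, mul_zero, zero_smul, map_zero, sub_zero,
    Real.norm_eq_abs, perpL_apply, map_sub, map_smul, smul_eq_mul] at h1
  have h1' : A * ε ^ 2 * t ≤ A * T * ε ^ 2 := by
    have := mul_le_mul_of_nonneg_left ht.2 (show 0 ≤ A * ε ^ 2 by positivity)
    linarith
  have h2 : |(ε / b x) * g (perp (X t - x))| ≤ m⁻¹ * L * D * ε ^ 2 := by
    have i1 : |g (perp (X t - x))| ≤ L * (D * ε) := by
      refine (g.le_of_opNorm_le (hf.norm_fderiv_le x) _).trans ?_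
      rw [norm_perp]
      have := hpos t ht
      gcongr
    have i2 := hf.inv_le x
    rw [abs_mul, abs_of_pos (div_pos hε hb), div_eq_mul_inv]
    calc _ ≤ ε * m⁻¹ * (L * (D * ε)) := by gcongr
      _ = _ := by ring
  have h3 : |t * (b (X t) - b x - (ε / b x) * g (perp (rot (φ t) w - w)))| ≤ A * T * ε ^ 2 := by
    rw [abs_mul, abs_of_nonneg ht.1]
    have i1 := hfield t ht
    have i2 := ht.2
    calc _ ≤ T * (A * ε ^ 2) := by gcongr
      _ = _ := by ring
  have h4 : |ε * t * ((logFDeriv b (X t) - logFDeriv b x) (perp (rot (φ t) w)))| ≤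
      T * ((m⁻¹ * L + m⁻¹ * m⁻¹ * L * L) * D * R) * ε ^ 2 := by
    have i1 : |(logFDeriv b (X t) - logFDeriv b x) (perp (rot (φ t) w))| ≤
        (m⁻¹ * L + m⁻¹ * m⁻¹ * L * L) * (D * ε) * R := by
      refine (ContinuousLinearMap.le_opNorm (logFDeriv b (X t) - logFDeriv b x) _).trans ?_
      rw [norm_perp, norm_rot]
      refine mul_le_mul ((hf.norm_logFDeriv_sub_le _ _).trans ?_) hw (norm_nonneg _)
        (by positivity)
      have := hpos t ht
      gcongr
    rw [abs_mul, abs_of_nonneg (mul_nonneg hε.le ht.1)]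
    have i2 := ht.2
    have i3 := ht.1
    calc _ ≤ ε * T * ((m⁻¹ * L + m⁻¹ * m⁻¹ * L * L) * (D * ε) * R) := by gcongr
      _ = _ := by ring
  have key : ε * (φ t - (b (X t) * t / ε - t * logFDeriv b (X t) (perp (rot (φ t) w)))) =
      (ε * φ t - b x * t - ε / b x * (g (perp (X t)) - g (perp x) - t * g (perp w)))
      + (ε / b x) * g (perp (X t - x))
      - t * (b (X t) - b x - (ε / b x) * g (perp (rot (φ t) w - w)))
      + ε * t * ((logFDeriv b (X t) - logFDeriv b x) (perp (rot (φ t) w))) := by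
    have e1 : logFDeriv b x (perp (rot (φ t) w)) = (b x)⁻¹ * g (perp (rot (φ t) w)) := rfl
    rw [sub_apply, e1, perp_sub, perp_sub, map_sub, map_sub]
    field_simp
    ring
  have hfin : ε * |φ t - (b (X t) * t / ε - t * logFDeriv b (X t) (perp (rot (φ t) w)))| ≤
      ε * (B * ε) := by
    rw [← abs_of_pos hε, ← abs_mul, abs_of_pos hε, key]
    refine (abs_add_le _ _).trans ((add_le_add ((abs_sub _ _).trans (add_le_add
      (abs_add_le _ _) le_rfl)) le_rfl).trans ?_)
    rw [hB]
    linarith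
  refine (le_of_mul_le_mul_left hfin hε).trans ?_
  gcongr
  linarith

/-! ### Existence on a time interval independent of `ε` -/

/-- The vector field of the characteristic system in the unknown `(X, φ)` is Lipschitz. -/
theorem FieldBounds.lipschitzWith_characteristicField {b : Plane → ℝ} {m L ε : ℝ}
    (hf : FieldBounds b m L) (hε : 0 < ε) (w : Plane) :
    LipschitzWith (max ‖w‖₊ (L / ε).toNNReal)
      (fun p : Plane × ℝ => (rot p.2 w, b p.1 / ε)) := by
  have hL := hf.pos_upper
  refine LipschitzWith.prodMk (LipschitzWith.of_dist_le_mul fun p q => ?_)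
    (LipschitzWith.of_dist_le_mul fun p q => ?_)
  · rw [dist_eq_norm, coe_nnnorm]
    refine (norm_rot_sub_rot_le _ _ w).trans ?_
    gcongr
    exact le_max_right (dist p.1 q.1) (dist p.2 q.2)
  · rw [Real.dist_eq, ← sub_div, abs_div, abs_of_pos hε, Real.coe_toNNReal _ (by positivity),
      div_mul_eq_mul_div]
    have h1 : ‖p.1 - q.1‖ ≤ dist p q := by
      rw [← dist_eq_norm]; exact le_max_left (dist p.1 q.1) (dist p.2 q.2)
    have h2 := hf.abs_sub_le p.1 q.1
    gcongr
    exact h2.trans (by gcongr)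

theorem exists_isCharacteristic {b : Plane → ℝ} {m L ε T : ℝ} (hf : FieldBounds b m L)
    (hε : 0 < ε) (hT : 0 ≤ T) (w x : Plane) :
    ∃ X φ, IsCharacteristic ε T b w x X φ := by
  have hL := hf.pos_upper
  obtain ⟨f, hf0, hfd⟩ := exists_trajectory (T := T) (L := ‖w‖₊ + (L / ε).toNNReal)
    (v := fun _ p => (rot p.2 w, b p.1 / ε))
    (fun _ => hf.lipschitzWith_characteristicField hε w) (fun _ => continuousOn_const)
    (fun t _ p => by
      have hLε : 0 ≤ L / ε := by positivity
      rw [NNReal.coe_add, Real.coe_toNNReal _ hLε, coe_nnnorm]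
      refine norm_prod_le_iff.2 ⟨?_, ?_⟩
      · simpa [norm_rot] using hLε
      · have h1 := hf.le_upper p.1
        rw [Real.norm_of_nonneg (div_nonneg (hf.pos_at _).le hε.le)]
        have : b p.1 / ε ≤ L / ε := by gcongr
        linarith [norm_nonneg w]) (t₀ := 0) ⟨le_rfl, hT⟩ (x, 0)
  exact ⟨fun t => (f t).1, fun t => (f t).2,
    { position_zero := by rw [hf0]
      phase_zero := by rw [hf0]
      position := fun t ht =>
        (ContinuousLinearMap.fst ℝ Plane ℝ).hasFDerivAt.comp_hasDerivWithinAt t (hfd t ht)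
      phase := fun t ht =>
        (ContinuousLinearMap.snd ℝ Plane ℝ).hasFDerivAt.comp_hasDerivWithinAt t (hfd t ht) }⟩

theorem IsCharacteristic.eqOn {b : Plane → ℝ} {m L ε T : ℝ} (hf : FieldBounds b m L)
    (hε : 0 < ε) (hT : 0 ≤ T) {w x : Plane} {X Y : ℝ → Plane} {φ ψ : ℝ → ℝ}
    (h : IsCharacteristic ε T b w x X φ) (h' : IsCharacteristic ε T b w x Y ψ) {t : ℝ}
    (ht : t ∈ Set.Icc 0 T) : X t = Y t ∧ φ t = ψ t := by
  have := eqOn_trajectories (v := fun _ p => (rot p.2 w, b p.1 / ε)) (T := T)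
    (f := fun t => (X t, φ t)) (g := fun t => (Y t, ψ t))
    (fun _ => hf.lipschitzWith_characteristicField hε w)
    (fun t ht => (h.position t ht).prodMk (h.phase t ht))
    (fun t ht => (h'.position t ht).prodMk (h'.phase t ht)) (s := 0) ⟨le_rfl, hT⟩
    (by simp [h.position_zero, h.phase_zero, h'.position_zero, h'.phase_zero]) ht
  exact Prod.mk.inj this

theorem IsCharacteristic.abs_phase_sub_le {b : Plane → ℝ} {m L ε T N : ℝ}
    (hf : FieldBounds b m L) (hε : 0 < ε) {w w' x x' : Plane} {X Y : ℝ → Plane} {φ ψ : ℝ → ℝ}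
    (h : IsCharacteristic ε T b w x X φ) (h' : IsCharacteristic ε T b w' x' Y ψ)
    (hN : ∀ t ∈ Set.Icc 0 T, ‖X t - Y t‖ ≤ N) {t : ℝ} (ht : t ∈ Set.Icc 0 T) :
    |φ t - ψ t| ≤ L * N / ε * T := by
  have hN0 : 0 ≤ N := (norm_nonneg _).trans (hN t ht)
  have hL := hf.pos_upper
  have := norm_sub_zero_le_of_hasDerivWithinAt (C := L * N / ε)
    (fun t ht => (h.phase t ht).sub (h'.phase t ht)) (fun t ht => by
      rw [Real.norm_eq_abs, ← sub_div, abs_div, abs_of_pos hε]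
      have h1 := hN t ht
      have h2 := hf.abs_sub_le (X t) (Y t)
      gcongr
      exact h2.trans (by gcongr)) ht
  simp only [Pi.sub_apply, h.phase_zero, h'.phase_zero, sub_zero, Real.norm_eq_abs] at this
  refine this.trans ?_
  have := ht.2
  gcongr

/-- The displacements `X - x` of two particles issued from a Lipschitz velocity field differ by
`O(T + ε)` times the distance of the particles. The factor `1/ε` in the rate of change of the
phase is compensated by the gyration radius, which is of order `ε`. -/
theorem exists_displacement_bound {m L R K : ℝ} (hR : 0 < R) (hK : 0 ≤ K) :
    ∃ C, 0 ≤ C ∧ ∀ b, FieldBounds b m L → ∀ ε, 0 < ε → ε ≤ 1 → ∀ T, 0 ≤ T → T ≤ 1 →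
      ∀ w w' x x' X Y φ ψ, ‖w‖ ≤ R → ‖w'‖ ≤ R → ‖w - w'‖ ≤ K * ‖x - x'‖ →
      IsCharacteristic ε T b w x X φ → IsCharacteristic ε T b w' x' Y ψ →
      ∀ M, (∀ t ∈ Set.Icc 0 T, ‖(X t - x) - (Y t - x')‖ ≤ M) →
      ∀ t ∈ Set.Icc 0 T, ‖(X t - x) - (Y t - x')‖ ≤ C * (T + ε) * (M + ‖x - x'‖) := by
  by_cases hex : ∃ b, FieldBounds b m L
  swap
  · exact ⟨0, le_rfl, fun b hb => (hex ⟨b, hb⟩).elim⟩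
  obtain ⟨b₀, hb₀⟩ := hex
  have hm : 0 < m⁻¹ := inv_pos.2 hb₀.pos
  have hL := hb₀.pos_upper
  set D := 2 * R * m⁻¹ * Real.exp (L * m⁻¹ * R) with hD
  have hD0 : 0 < D := by positivity
  set A := m⁻¹ * (K + R * L) + m⁻¹ * K + m⁻¹ * m⁻¹ * L * (2 * R) with hA
  set B := (L + L * D) * m⁻¹ * R + L * D * (m⁻¹ * m⁻¹ * L) * R + L * D * m⁻¹ * (K + R * L) with hB
  have hA0 : 0 ≤ A := by positivity
  have hB0 : 0 ≤ B := by positivity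
  refine ⟨A + B, by positivity, ?_⟩
  intro b hf ε hε hε1 T hT hT1 w w' x x' X Y φ ψ hw hw' hww c c' M hM t ht
  have hM0 : 0 ≤ M := (norm_nonneg _).trans (hM t ht)
  set δ := ‖x - x'‖ with hδ
  have hδ0 : 0 ≤ δ := norm_nonneg _
  set N := M + δ with hN
  have hδN : δ ≤ N := by linarith
  have hN0 : 0 ≤ N := by positivity
  have hXY : ∀ t ∈ Set.Icc 0 T, ‖X t - Y t‖ ≤ N := by
    intro t ht
    have e : X t - Y t = ((X t - x) - (Y t - x')) + (x - x') := by abel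
    rw [e]
    exact (norm_add_le _ _).trans (add_le_add (hM t ht) le_rfl)
  -- the difference of the velocities, of order `1 + T / ε`
  have hV : ∀ t ∈ Set.Icc 0 T, ε * ‖rot (φ t) w - rot (ψ t) w'‖ ≤ (K * ε + R * L * T) * N := by
    intro t ht
    have h1 := norm_rot_sub_rot_le' (φ t) (ψ t) w w'
    have h2 := c.abs_phase_sub_le hf hε c' hXY ht
    have h3 : ‖rot (φ t) w - rot (ψ t) w'‖ ≤ K * N + R * (L * N / ε * T) := by
      refine h1.trans (add_le_add (hww.trans (by gcongr)) ?_)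
      gcongr
    calc _ ≤ ε * (K * N + R * (L * N / ε * T)) := by gcongr
      _ = _ := by field_simp
  have hV1 : ∀ t ∈ Set.Icc 0 T, ε * ‖rot (φ t) w - rot (ψ t) w'‖ ≤ (K + R * L) * N := by
    intro t ht
    refine (hV t ht).trans ?_
    have h1 : K * ε ≤ K := mul_le_of_le_one_right hK hε1
    have h2 : R * L * T ≤ R * L := mul_le_of_le_one_right (by positivity) hT1
    gcongr
  have hbinv : |(b x)⁻¹ - (b x')⁻¹| ≤ m⁻¹ * m⁻¹ * L * N :=
    (hf.abs_inv_sub_inv_le x x').trans (by gcongr)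
  have hbx := inv_nonneg.2 (hf.pos_at x).le
  have hbx' := inv_nonneg.2 (hf.pos_at x').le
  -- the difference of the gyrations
  have hgyr : ‖(ε / b x) • perp (rot (φ t) w - w) - (ε / b x') • perp (rot (ψ t) w' - w')‖ ≤
      A * (T + ε) * N := by
    have e : (ε / b x) • perp (rot (φ t) w - w) - (ε / b x') • perp (rot (ψ t) w' - w') =
        (b x)⁻¹ • (ε • perp ((rot (φ t) w - rot (ψ t) w') - (w - w')))
        + (ε * ((b x)⁻¹ - (b x')⁻¹)) • perp (rot (ψ t) w' - w') := by
      simp only [perp_sub, div_eq_mul_inv]; module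
    rw [e]
    have h1 : ‖(b x)⁻¹ • (ε • perp ((rot (φ t) w - rot (ψ t) w') - (w - w')))‖ ≤
        m⁻¹ * ((K * ε + R * L * T) * N + ε * (K * N)) := by
      rw [norm_smul, norm_smul, norm_perp, Real.norm_of_nonneg hbx, Real.norm_of_nonneg hε.le]
      have i1 := hf.inv_le x
      have i2 := hV t ht
      have i3 : ‖w - w'‖ ≤ K * N := hww.trans (by gcongr)
      have i4 : ε * ‖(rot (φ t) w - rot (ψ t) w') - (w - w')‖ ≤
          (K * ε + R * L * T) * N + ε * (K * N) := by
        refine (mul_le_mul_of_nonneg_left (norm_sub_le _ _) hε.le).trans ?_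
        rw [mul_add]; gcongr
      gcongr
    have h2 : ‖(ε * ((b x)⁻¹ - (b x')⁻¹)) • perp (rot (ψ t) w' - w')‖ ≤
        ε * (m⁻¹ * m⁻¹ * L * N) * (2 * R) := by
      rw [norm_smul, norm_perp, norm_mul, Real.norm_of_nonneg hε.le, Real.norm_eq_abs]
      have i1 : ‖rot (ψ t) w' - w'‖ ≤ 2 * R := by
        linarith [norm_sub_le (rot (ψ t) w') w', norm_rot (ψ t) w']
      gcongr
    refine (norm_add_le _ _).trans ((add_le_add h1 h2).trans ?_)
    have e2 : A * (T + ε) * N - (m⁻¹ * ((K * ε + R * L * T) * N + ε * (K * N))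
        + ε * (m⁻¹ * m⁻¹ * L * N) * (2 * R)) =
        m⁻¹ * (K * T + R * L * ε) * N + m⁻¹ * K * T * N + m⁻¹ * m⁻¹ * L * (2 * R) * T * N := by
      rw [hA]; ring
    have : 0 ≤ m⁻¹ * (K * T + R * L * ε) * N + m⁻¹ * K * T * N
        + m⁻¹ * m⁻¹ * L * (2 * R) * T * N := by positivity
    linarith
  -- the difference of the gyration errors
  have hpos : ∀ t ∈ Set.Icc 0 T, ‖Y t - x'‖ ≤ D * ε := by
    intro t ht
    refine (c'.norm_position_sub_le hε hf hR hw' ht).trans ?_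
    rw [hD]
    have : L * m⁻¹ * R * T ≤ L * m⁻¹ * R := mul_le_of_le_one_right (by positivity) hT1
    gcongr
  have herr := norm_sub_zero_le_of_hasDerivWithinAt (C := B * N)
    (fun t ht => (c.hasDerivWithinAt_gyrationError hε (hf.pos_at x) ht).sub
      (c'.hasDerivWithinAt_gyrationError hε (hf.pos_at x') ht)) (fun t ht => by
    have e : (-((b (X t) - b x) / b x)) • rot (φ t) w - (-((b (Y t) - b x') / b x')) • rot (ψ t) w'
        = -((((b (X t) - b x) - (b (Y t) - b x')) * (b x)⁻¹) • rot (φ t) w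
          + ((b (Y t) - b x') * ((b x)⁻¹ - (b x')⁻¹)) • rot (φ t) w
          + ((b (Y t) - b x') * (b x')⁻¹) • (rot (φ t) w - rot (ψ t) w')) := by
      simp only [div_eq_mul_inv]; module
    have i1 : |(b (X t) - b x) - (b (Y t) - b x')| ≤ (L + L * D) * N := by
      have s1 := hf.abs_sub_le (X t) (x + (Y t - x'))
      have s2 := hf.abs_second_difference_le (Y t - x') x x'
      have e1 : X t - (x + (Y t - x')) = (X t - x) - (Y t - x') := by abel
      have e2 : x' + (Y t - x') = Y t := by abel
      rw [e1] at s1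
      rw [e2] at s2
      have s3 : L * ‖(X t - x) - (Y t - x')‖ ≤ L * N := by
        have := hM t ht
        gcongr
        linarith
      have s4 : L * ‖Y t - x'‖ * ‖x - x'‖ ≤ L * D * N := by
        have := (hpos t ht).trans (mul_le_of_le_one_right hD0.le hε1)
        gcongr
      have e3 : (b (X t) - b x) - (b (Y t) - b x') = (b (X t) - b (x + (Y t - x')))
          + ((b (x + (Y t - x')) - b x) - (b (Y t) - b x')) := by ring
      rw [e3]
      refine (abs_add_le _ _).trans ?_
      linarith
    have i2 : |b (Y t) - b x'| ≤ L * D * ε := by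
      refine (hf.abs_sub_le _ _).trans ?_
      rw [mul_assoc]
      have := hpos t ht
      gcongr
    have i2' : |b (Y t) - b x'| ≤ L * D := i2.trans (mul_le_of_le_one_right (by positivity) hε1)
    have t1 : ‖(((b (X t) - b x) - (b (Y t) - b x')) * (b x)⁻¹) • rot (φ t) w‖ ≤
        (L + L * D) * N * m⁻¹ * R := by
      rw [norm_smul, norm_mul, norm_rot, Real.norm_eq_abs, Real.norm_of_nonneg hbx]
      have := hf.inv_le x
      gcongr
    have t2 : ‖((b (Y t) - b x') * ((b x)⁻¹ - (b x')⁻¹)) • rot (φ t) w‖ ≤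
        L * D * (m⁻¹ * m⁻¹ * L * N) * R := by
      rw [norm_smul, norm_mul, norm_rot, Real.norm_eq_abs, Real.norm_eq_abs]
      gcongr
    have t3 : ‖((b (Y t) - b x') * (b x')⁻¹) • (rot (φ t) w - rot (ψ t) w')‖ ≤
        L * D * m⁻¹ * ((K + R * L) * N) := by
      rw [norm_smul, norm_mul, Real.norm_eq_abs, Real.norm_of_nonneg hbx']
      have j1 := hf.inv_le x'
      have j2 := hV1 t ht
      calc _ ≤ L * D * ε * m⁻¹ * ‖rot (φ t) w - rot (ψ t) w'‖ := by gcongr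
        _ = L * D * m⁻¹ * (ε * ‖rot (φ t) w - rot (ψ t) w'‖) := by ring
        _ ≤ _ := by gcongr
    rw [e, norm_neg]
    refine (norm_add_le _ _).trans ((add_le_add ((norm_add_le _ _).trans (add_le_add t1 t2))
      t3).trans (le_of_eq ?_))
    rw [hB]; ring) ht
  simp only [Pi.sub_apply, c.gyrationError_zero, c'.gyrationError_zero, sub_zero] at herr
  have herr' : B * N * t ≤ B * (T + ε) * N := by
    have : B * N * t ≤ B * N * (T + ε) := by
      gcongr
      linarith [ht.2]
    linarith
  have e : (X t - x) - (Y t - x') =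
      (IsCharacteristic.gyrationError ε b w x X φ t
        - IsCharacteristic.gyrationError ε b w' x' Y ψ t)
      + ((ε / b x) • perp (rot (φ t) w - w) - (ε / b x') • perp (rot (ψ t) w' - w')) := by
    simp only [IsCharacteristic.gyrationError]; abel
  rw [e]
  refine (norm_add_le _ _).trans ((add_le_add (herr.trans herr') hgyr).trans (le_of_eq ?_))
  ring

/-- For small times and small `ε`, the flow of the characteristics is a perturbation of the
identity by a contraction. -/
theorem exists_contraction_time {m L R K : ℝ} (hR : 0 < R) (hK : 0 ≤ K) :
    ∃ τ, 0 < τ ∧ ∀ b, FieldBounds b m L → ∀ ε, 0 < ε → ε ≤ τ → ∀ T, 0 ≤ T → T ≤ τ →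
      ∀ w w' x x' X Y φ ψ, ‖w‖ ≤ R → ‖w'‖ ≤ R → ‖w - w'‖ ≤ K * ‖x - x'‖ →
      IsCharacteristic ε T b w x X φ → IsCharacteristic ε T b w' x' Y ψ →
      ∀ t ∈ Set.Icc 0 T, ‖(X t - x) - (Y t - x')‖ ≤ 1 / 3 * ‖x - x'‖ := by
  obtain ⟨C, hC, h⟩ := exists_displacement_bound (m := m) (L := L) hR hK
  refine ⟨min 1 (1 / (8 * C + 1)), by positivity, ?_⟩
  intro b hf ε hε hετ T hT hTτ w w' x x' X Y φ ψ hw hw' hww c c' t ht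
  have hcont : ContinuousOn (fun t => ‖(X t - x) - (Y t - x')‖) (Set.Icc 0 T) := by
    have h1 : ContinuousOn X (Set.Icc 0 T) := fun t ht => (c.position t ht).continuousWithinAt
    have h2 : ContinuousOn Y (Set.Icc 0 T) := fun t ht => (c'.position t ht).continuousWithinAt
    fun_prop
  obtain ⟨s, hs, hmax⟩ := isCompact_Icc.exists_isMaxOn ⟨t, ht⟩ hcont
  have key := h b hf ε hε (hετ.trans (min_le_left _ _)) T hT (hTτ.trans (min_le_left _ _))
    w w' x x' X Y φ ψ hw hw' hww c c' _ (fun t ht => hmax ht) s hs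
  have hsmall : C * (T + ε) ≤ 1 / 4 := by
    have h1 : T + ε ≤ 2 * (1 / (8 * C + 1)) := by
      linarith [hετ.trans (min_le_right _ _), hTτ.trans (min_le_right _ _)]
    have h2 : C * (2 * (1 / (8 * C + 1))) ≤ 1 / 4 := by
      rw [← mul_assoc, mul_one_div, div_le_div_iff₀ (by positivity) (by norm_num)]
      linarith
    exact (mul_le_mul_of_nonneg_left h1 hC).trans h2
  have h3 := mul_le_mul_of_nonneg_right hsmall
    (show 0 ≤ ‖(X s - x) - (Y s - x')‖ + ‖x - x'‖ by positivity)
  have h4 : ‖(X t - x) - (Y t - x')‖ ≤ ‖(X s - x) - (Y s - x')‖ := hmax ht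
  linarith

/-- A map that differs from the identity by a contraction is onto. -/
theorem surjective_of_norm_sub_le {f : Plane → Plane}
    (h : ∀ x y, ‖(f x - x) - (f y - y)‖ ≤ 1 / 3 * ‖x - y‖) : Function.Surjective f := by
  intro z
  have hc : ContractingWith (1 / 3) (fun x => z - (f x - x)) := by
    refine ⟨by norm_num, LipschitzWith.of_dist_le_mul fun x y => ?_⟩
    have := h x y
    rw [dist_eq_norm, dist_eq_norm, sub_sub_sub_cancel_left, norm_sub_rev]
    simpa using this
  have hx : z - (f hc.fixedPoint - hc.fixedPoint) = hc.fixedPoint := hc.fixedPoint_isFixedPt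
  refine ⟨hc.fixedPoint, ?_⟩
  have : z - f hc.fixedPoint = 0 := by
    rw [sub_sub_eq_add_sub, add_sub_right_comm] at hx
    simpa using hx
  exact (sub_eq_zero.1 this).symm

/-- Partial derivatives of a function of time and space that is differentiable at `p`, and its
derivative along a curve through `p`. -/
theorem HasFDerivAt.partials {u : ℝ → Plane → Plane} {p : ℝ × Plane}
    {D : ℝ × Plane →L[ℝ] Plane} (h : HasFDerivAt (fun p : ℝ × Plane => u p.1 p.2) D p) :
    HasDerivAt (fun τ => u τ p.2) (D (1, 0)) p.1 ∧
      HasFDerivAt (u p.1) (D.comp (ContinuousLinearMap.inr ℝ ℝ Plane)) p.2 ∧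
      ∀ {X : ℝ → Plane} {v : Plane}, X p.1 = p.2 → HasDerivAt X v p.1 →
        HasDerivAt (fun τ => u τ (X τ))
          (D (1, 0) + D.comp (ContinuousLinearMap.inr ℝ ℝ Plane) v) p.1 := by
  have key : ∀ {X : ℝ → Plane} {v : Plane}, X p.1 = p.2 → HasDerivAt X v p.1 →
        HasDerivAt (fun τ => u τ (X τ)) (D (1, v)) p.1 := by
    intro X v hX hv
    have h' : HasFDerivAt (fun p : ℝ × Plane => u p.1 p.2) D (p.1, X p.1) := by rwa [hX]
    exact h'.comp_hasDerivAt (f := fun τ => (τ, X τ)) p.1 ((hasDerivAt_id p.1).prodMk hv)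
  refine ⟨key rfl (hasDerivAt_const p.1 p.2), ?_, fun {X v} hX hv => ?_⟩
  · exact h.comp (g := fun p : ℝ × Plane => u p.1 p.2) (f := fun y => (p.1, y)) p.2
      (hasFDerivAt_prodMk_right p.1 p.2)
  · refine (key hX hv).congr_deriv ?_
    rw [ContinuousLinearMap.comp_apply, ContinuousLinearMap.inr_apply, ← map_add]
    simp

instance isAddHaarMeasure_volume_time_space :
    (volume : Measure (ℝ × Plane)).IsAddHaarMeasure :=
  inferInstanceAs ((volume : Measure ℝ).prod (volume : Measure Plane)).IsAddHaarMeasure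

theorem Icc_prod_univ_mem_nhds {T : ℝ} {p : ℝ × Plane} (hp : p.1 ∈ Set.Ioo 0 T) :
    Set.Icc 0 T ×ˢ (Set.univ : Set Plane) ∈ 𝓝 p :=
  prod_mem_nhds (Icc_mem_nhds hp.1 hp.2) univ_mem

/-- Existence, on a time interval independent of `ε`: the velocity is transported by the
characteristics, which form a bi-Lipschitz flow. -/
theorem exists_isBurgersSolution {b : Plane → ℝ} {m L R : ℝ} {K : NNReal} {u₀ v : Plane → Plane}
    (hf : FieldBounds b m L) (hR : 0 < R) (hv : LipschitzWith K v) (hvR : ∀ x, ‖v x‖ ≤ R)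
    (huv : u₀ =ᵐ[volume] v) :
    ∃ τ, 0 < τ ∧ ∀ T, 0 < T → T ≤ τ → ∀ ε, 0 < ε → ε ≤ τ →
      ∃ u, IsBurgersSolution 1 ε T b u₀ u := by
  obtain ⟨τ, hτ, hc⟩ := exists_contraction_time (m := m) (L := L) hR K.2
  refine ⟨τ, hτ, fun T hT hTτ ε hε hετ => ?_⟩
  choose X φ c using fun x => exists_isCharacteristic hf hε hT.le (v x) x
  have hL := hf.pos_upper
  have hX : ∀ x y, ∀ t ∈ Set.Icc 0 T, ‖(X x t - x) - (X y t - y)‖ ≤ 1 / 3 * ‖x - y‖ :=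
    fun x y => hc b hf ε hε hετ T hT.le hTτ _ _ x y _ _ _ _ (hvR x) (hvR y)
      (hv.norm_sub_le x y) (c x) (c y)
  have hX1 : ∀ x y, ∀ t ∈ Set.Icc 0 T, ‖X x t - X y t‖ ≤ 2 * ‖x - y‖ := by
    intro x y t ht
    have e : X x t - X y t = ((X x t - x) - (X y t - y)) + (x - y) := by abel
    rw [e]
    linarith [norm_add_le ((X x t - x) - (X y t - y)) (x - y), hX x y t ht, norm_nonneg (x - y)]
  have hX2 : ∀ x y, ∀ t ∈ Set.Icc 0 T, ‖x - y‖ ≤ 2 * ‖X x t - X y t‖ := by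
    intro x y t ht
    have e : x - y = (X x t - X y t) - ((X x t - x) - (X y t - y)) := by abel
    have := norm_sub_le (X x t - X y t) ((X x t - x) - (X y t - y))
    rw [← e] at this
    linarith [hX x y t ht, norm_nonneg (X x t - X y t)]
  have hsurj : ∀ t ∈ Set.Icc 0 T, ∀ y, ∃ x, X x t = y := fun t ht =>
    surjective_of_norm_sub_le fun x y => hX x y t ht
  choose! Y hY using hsurj
  set u : ℝ → Plane → Plane := fun t y => rot (φ (Y t y) t) (v (Y t y)) with hu
  have hut : ∀ t ∈ Set.Icc 0 T, ∀ x, u t (X x t) = rot (φ x t) (v x) := by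
    intro t ht x
    have : Y t (X x t) = x := by
      have := hX2 (Y t (X x t)) x t ht
      rw [hY t ht, sub_self, norm_zero, mul_zero] at this
      exact sub_eq_zero.1 (norm_le_zero_iff.1 this)
    simp only [hu, this]
  have huR : ∀ t y, ‖u t y‖ ≤ R := fun t y => by rw [hu, norm_rot]; exact hvR _
  set A : ℝ := 2 * (K + R * (L * 2 / ε * T)) with hA
  have hA0 : 0 ≤ A := by positivity
  have hspace : ∀ t ∈ Set.Icc 0 T, ∀ y z, ‖u t y - u t z‖ ≤ A * ‖y - z‖ := by
    intro t ht y z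
    obtain ⟨x, rfl⟩ : ∃ x, X x t = y := ⟨_, hY t ht y⟩
    obtain ⟨x', rfl⟩ : ∃ x, X x t = z := ⟨_, hY t ht z⟩
    rw [hut t ht, hut t ht]
    have h1 := (c x).abs_phase_sub_le hf hε (c x') (hX1 x x') ht
    have h2 : ‖rot (φ x t) (v x) - rot (φ x' t) (v x')‖ ≤
        K * ‖x - x'‖ + R * (L * (2 * ‖x - x'‖) / ε * T) := by
      refine (norm_rot_sub_rot_le' _ _ _ _).trans (add_le_add (hv.norm_sub_le x x') ?_)
      have := hvR x'
      gcongr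
    have e : K * ‖x - x'‖ + R * (L * (2 * ‖x - x'‖) / ε * T) =
        (K + R * (L * 2 / ε * T)) * ‖x - x'‖ := by ring
    rw [e] at h2
    have h3 := hX2 x x' t ht
    calc _ ≤ _ := h2
      _ ≤ (K + R * (L * 2 / ε * T)) * (2 * ‖X x t - X x' t‖) := by gcongr
      _ = _ := by rw [hA]; ring
  have htime : ∀ s ∈ Set.Icc 0 T, ∀ t ∈ Set.Icc 0 T, ∀ z,
      ‖u t z - u s z‖ ≤ (A * R + L / ε * R) * |t - s| := by
    intro s hs t ht z
    obtain ⟨x, rfl⟩ : ∃ x, X x s = z := ⟨_, hY s hs z⟩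
    have h1 := hspace t ht (X x s) (X x t)
    have h2 : ‖X x s - X x t‖ ≤ R * |t - s| := by
      rw [norm_sub_rev]
      exact norm_sub_le_of_hasDerivWithinAt (c x).position
        (fun t _ => by rw [norm_rot]; exact hvR x) hs ht
    have h3 : ‖rot (φ x t) (v x) - rot (φ x s) (v x)‖ ≤ L / ε * R * |t - s| := by
      refine norm_sub_le_of_hasDerivWithinAt (fun t ht => (c x).velocity ht) (fun t _ => ?_) hs ht
      rw [norm_neg, norm_smul, norm_perp, norm_rot,
        Real.norm_of_nonneg (div_nonneg (hf.pos_at _).le hε.le)]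
      have i1 := hf.le_upper (X x t)
      have i2 := hvR x
      gcongr
    rw [← hut t ht, ← hut s hs] at h3
    have e : u t (X x s) - u s (X x s) = (u t (X x s) - u t (X x t))
        + (u t (X x t) - u s (X x s)) := by abel
    rw [e]
    refine (norm_add_le _ _).trans ((add_le_add (h1.trans
      (mul_le_mul_of_nonneg_left h2 hA0)) h3).trans (le_of_eq ?_))
    ring
  have hlip : LipschitzOnWith (A + (A * R + L / ε * R)).toNNReal
      (fun p : ℝ × Plane => u p.1 p.2) (Set.Icc 0 T ×ˢ Set.univ) := by
    refine LipschitzOnWith.of_dist_le_mul fun p hp q hq => ?_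
    rw [Real.coe_toNNReal _ (by positivity), dist_eq_norm]
    have h1 : ‖p.2 - q.2‖ ≤ dist p q := by
      rw [← dist_eq_norm]; exact le_max_right (dist p.1 q.1) (dist p.2 q.2)
    have h2 : |p.1 - q.1| ≤ dist p q := by
      rw [← Real.dist_eq]; exact le_max_left (dist p.1 q.1) (dist p.2 q.2)
    have h3 := hspace p.1 hp.1 p.2 q.2
    have h4 := htime q.1 hq.1 p.1 hp.1 q.2
    have e : u p.1 p.2 - u q.1 q.2 = (u p.1 p.2 - u p.1 q.2) + (u p.1 q.2 - u q.1 q.2) := by abel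
    rw [e, add_mul]
    exact (norm_add_le _ _).trans (add_le_add (h3.trans (by gcongr)) (h4.trans (by gcongr)))
  refine ⟨u, ⟨_, hlip⟩, ⟨R + 2 * A.toNNReal, ?_⟩, ?_, ?_⟩
  · filter_upwards [ae_restrict_mem measurableSet_Icc] with t ht
    refine LipschitzWith.sobolevInfBound_one (LipschitzWith.of_dist_le_mul fun y z => ?_) (huR t)
    rw [Real.coe_toNNReal _ hA0, dist_eq_norm, dist_eq_norm]
    exact hspace t ht y z
  · have h0 : u 0 = v := by
      funext x
      have := hut 0 ⟨le_rfl, hT.le⟩ x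
      rwa [(c x).position_zero, (c x).phase_zero, rot_zero] at this
    rw [h0]; exact huv.symm
  · have hmeas : MeasurableSet (Set.Ioo 0 T ×ˢ (Set.univ : Set Plane)) :=
      measurableSet_Ioo.prod MeasurableSet.univ
    rw [ae_restrict_iff' hmeas]
    filter_upwards [hlip.ae_differentiableWithinAt_of_mem (μ := volume)] with p hp hpT
    have hpI : p.1 ∈ Set.Icc 0 T := Set.Ioo_subset_Icc_self hpT.1
    have hd := ((hp ⟨hpI, trivial⟩).differentiableAt
      (Icc_prod_univ_mem_nhds hpT.1)).hasFDerivAt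
    obtain ⟨h1, h2, h3⟩ := hd.partials
    refine ⟨_, _, h1, h2, ?_⟩
    set x := Y p.1 p.2 with hx
    have hxp : X x p.1 = p.2 := hY p.1 hpI p.2
    have hnhds : Set.Icc 0 T ∈ 𝓝 p.1 := Icc_mem_nhds hpT.1.1 hpT.1.2
    have h4 := h3 hxp (((c x).position p.1 hpI).hasDerivAt hnhds)
    have h5 := ((c x).velocity hpI).hasDerivAt hnhds
    have h6 := h5.congr_of_eventuallyEq (f₁ := fun τ => u τ (X x τ))
      (mem_of_superset hnhds fun t ht => hut t ht x)
    have h7 := h4.unique h6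
    rw [← hut p.1 hpI x, hxp] at h7
    rw [h7, neg_add_cancel]

/-! ### Lipschitz solutions are transported by the characteristics -/

section Flow

variable {u : ℝ → Plane → Plane} {K : NNReal} {T : ℝ}

theorem LipschitzOnWith.space (h : LipschitzOnWith K (fun p : ℝ × Plane => u p.1 p.2)
    (Set.Icc 0 T ×ˢ Set.univ)) {t : ℝ} (ht : t ∈ Set.Icc 0 T) : LipschitzWith K (u t) :=
  LipschitzWith.of_dist_le_mul fun x y => by
    simpa [Prod.dist_eq] using h.dist_le_mul (t, x) ⟨ht, trivial⟩ (t, y) ⟨ht, trivial⟩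

theorem LipschitzOnWith.time (h : LipschitzOnWith K (fun p : ℝ × Plane => u p.1 p.2)
    (Set.Icc 0 T ×ˢ Set.univ)) (x : Plane) : LipschitzOnWith K (fun t => u t x) (Set.Icc 0 T) :=
  LipschitzOnWith.of_dist_le_mul fun s hs t ht => by
    simpa [Prod.dist_eq] using h.dist_le_mul (s, x) ⟨hs, trivial⟩ (t, x) ⟨ht, trivial⟩

/-- The flow of a bounded Lipschitz time-dependent vector field: a bi-Lipschitz homeomorphism
of the plane at each time. -/
theorem exists_flow (hT : 0 ≤ T) {R : ℝ} (hlip : LipschitzOnWith K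
      (fun p : ℝ × Plane => u p.1 p.2) (Set.Icc 0 T ×ˢ Set.univ))
    (hR : ∀ t ∈ Set.Icc 0 T, ∀ x, ‖u t x‖ ≤ R) :
    ∃ (X : Plane → ℝ → Plane) (C : NNReal), (∀ x, X x 0 = x) ∧
      (∀ x, ∀ t ∈ Set.Icc 0 T, HasDerivWithinAt (X x) (u t (X x t)) (Set.Icc 0 T) t) ∧
      (∀ t ∈ Set.Icc 0 T, LipschitzWith C (fun x => X x t)) ∧
      (∀ t ∈ Set.Icc 0 T, AntilipschitzWith C (fun x => X x t)) ∧
      ∀ t ∈ Set.Icc 0 T, Function.Surjective (fun x => X x t) := by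
  set v : ℝ → Plane → Plane := fun t => u (Set.projIcc 0 T hT t) with hv
  have hvu : ∀ t ∈ Set.Icc 0 T, v t = u t := fun t ht => by
    simp only [hv, Set.projIcc_of_mem hT ht]
  have hvl : ∀ t, LipschitzWith K (v t) := fun t => hlip.space (Set.projIcc 0 T hT t).2
  have h0 : (0 : ℝ) ∈ Set.Icc 0 T := ⟨le_rfl, hT⟩
  have hex := fun (t₀ : ℝ) (ht₀ : t₀ ∈ Set.Icc 0 T) (x : Plane) =>
    exists_trajectory (T := T) (L := R.toNNReal) hvl
      (fun x => (hlip.time x).continuousOn.congr fun t ht => by rw [hvu t ht])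
      (fun t ht x => by
        rw [hvu t ht]
        exact (hR t ht x).trans (Real.le_coe_toNNReal R)) ht₀ x
  choose X hX0 hX using fun x => hex 0 h0 x
  set C : NNReal := (Real.exp (K * T)).toNNReal with hC
  have hCe : (C : ℝ) = Real.exp (K * T) := Real.coe_toNNReal _ (Real.exp_pos _).le
  refine ⟨X, C, hX0, fun x t ht => by rw [← hvu t ht]; exact hX x t ht, fun t ht => ?_,
    fun t ht => ?_, fun t ht y => ?_⟩
  · refine LipschitzWith.of_dist_le_mul fun x y => ?_
    have := dist_trajectories_le hvl (hX x) (hX y) h0 ht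
    rw [hX0, hX0] at this
    rw [hCe, mul_comm]; exact this
  · refine AntilipschitzWith.of_le_mul_dist fun x y => ?_
    have := dist_trajectories_le hvl (hX x) (hX y) ht h0
    rw [hX0, hX0] at this
    rw [hCe, mul_comm]; exact this
  · obtain ⟨Z, hZt, hZ⟩ := hex t ht y
    refine ⟨Z 0, ?_⟩
    have := eqOn_trajectories hvl (hX (Z 0)) hZ h0 (hX0 _) ht
    exact this.trans hZt

end Flow

/-- Preimages of null sets under antilipschitz maps of the plane are null. -/
theorem AntilipschitzWith.volume_preimage_eq_zero {f : Plane → Plane} {C : NNReal}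
    (hf : AntilipschitzWith C f) {s : Set Plane} (hs : volume s = 0) : volume (f ⁻¹' s) = 0 := by
  have hac : (volume : Measure Plane) ≪ μH[(Module.finrank ℝ Plane : ℝ)] :=
    Measure.absolutelyContinuous_isAddHaarMeasure _ _
  have hac' : μH[(Module.finrank ℝ Plane : ℝ)] ≪ (volume : Measure Plane) :=
    Measure.absolutelyContinuous_isAddHaarMeasure _ _
  have h := hf.hausdorffMeasure_preimage_le (Nat.cast_nonneg (Module.finrank ℝ Plane)) s
  rw [hac' hs, mul_zero] at h
  exact hac (le_antisymm h zero_le)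

/-- A property that holds almost everywhere in space-time holds, for almost every `x`, at almost
every time along the trajectory of `x`. -/
theorem ae_ae_along_flow {T : ℝ} (hT : 0 ≤ T) {X : Plane → ℝ → Plane} {C R : NNReal}
    (hX : ∀ t ∈ Set.Icc 0 T, LipschitzWith C (fun x => X x t))
    (hX' : ∀ t ∈ Set.Icc 0 T, AntilipschitzWith C (fun x => X x t))
    (hXt : ∀ x, LipschitzOnWith R (X x) (Set.Icc 0 T)) {P : ℝ × Plane → Prop}
    (hP : ∀ᵐ p : ℝ × Plane, P p) :
    ∀ᵐ x : Plane, ∀ᵐ t : ℝ, t ∈ Set.Icc 0 T → P (t, X x t) := by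
  obtain ⟨N, hPN, hNm, hN⟩ := exists_measurable_superset_of_null (ae_iff.1 hP)
  set Ψ : ℝ × Plane → ℝ × Plane := fun p =>
    ((Set.projIcc 0 T hT p.1 : ℝ), X p.2 (Set.projIcc 0 T hT p.1)) with hΨ
  have hcont : Continuous Ψ := by
    refine (continuous_subtype_val.comp (continuous_projIcc.comp continuous_fst)).prodMk ?_
    have : LipschitzWith (R * 1 + C)
        (Function.uncurry fun (t : ℝ) (x : Plane) => X x (Set.projIcc 0 T hT t)) := by
      refine LipschitzWith.uncurry (fun x => ?_) fun t => hX _ (Set.projIcc 0 T hT t).2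
      exact ((lipschitzOnWith_iff_restrict.1 (hXt x)).comp (LipschitzWith.projIcc hT))
    exact this.continuous
  have hmeas : MeasurableSet {p : ℝ × Plane | p.1 ∈ Set.Icc 0 T → (p.1, X p.2 p.1) ∉ N} := by
    have : {p : ℝ × Plane | p.1 ∈ Set.Icc 0 T → (p.1, X p.2 p.1) ∉ N} =
        {p | p.1 ∈ Set.Icc 0 T}ᶜ ∪ (Ψ ⁻¹' N)ᶜ := by
      ext p
      simp only [Set.mem_ofPred_eq, Set.mem_union, Set.mem_compl_iff, Set.mem_preimage]
      by_cases h : p.1 ∈ Set.Icc 0 T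
      · simp only [h, forall_const, not_true_eq_false, false_or, hΨ, Set.projIcc_of_mem hT h]
      · simp [h]
    rw [this]
    exact (measurable_fst measurableSet_Icc).compl.union (hcont.measurable hNm).compl
  have hNt := Measure.measure_ae_null_of_prod_null (μ := (volume : Measure ℝ))
    (ν := (volume : Measure Plane)) hN
  have h1 : ∀ᵐ t : ℝ, ∀ᵐ x : Plane, t ∈ Set.Icc 0 T → (t, X x t) ∉ N := by
    filter_upwards [hNt] with t ht
    by_cases hI : t ∈ Set.Icc 0 T
    · have := (hX' t hI).volume_preimage_eq_zero ht
      filter_upwards [measure_eq_zero_iff_ae_notMem.1 this] with x hx _ using hx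
    · exact Eventually.of_forall fun x h => (hI h).elim
  have h2 := (Measure.ae_ae_comm (μ := (volume : Measure ℝ)) (ν := (volume : Measure Plane))
    (p := fun t x => t ∈ Set.Icc 0 T → (t, X x t) ∉ N) hmeas).1 h1
  filter_upwards [h2] with x hx
  filter_upwards [hx] with t ht hI
  by_contra hcon
  exact ht hI (hPN hcon)

/-- If `V' = -φ' V^⊥`, then `V`, rotated back by the angle `φ`, is stationary. -/
theorem hasDerivAt_rot_neg_zero {φ : ℝ → ℝ} {V : ℝ → Plane} {φ' t : ℝ} (hφ : HasDerivAt φ φ' t)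
    (hV : HasDerivAt V (-(φ' • perp (V t))) t) :
    HasDerivAt (fun τ => rot (-φ τ) (V τ)) 0 t := by
  have h1 := hφ.neg.cos.smul hV
  have h2 := hφ.neg.sin.smul (perpL.hasFDerivAt.comp_hasDerivAt t hV)
  refine HasDerivAt.congr_deriv (f := fun τ => rot (-φ τ) (V τ)) (h1.sub h2) ?_
  have e : perpL (-(φ' • perp (V t))) = φ' • V t := by
    rw [map_neg, map_smul, perpL_apply, perp_perp, smul_neg, neg_neg]
  rw [e]
  simp only [Function.comp_apply, perpL_apply, Pi.neg_apply]
  module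

/-- The phase accumulated along a trajectory. -/
theorem exists_phase_along {b : Plane → ℝ} (hb : Continuous b) {T ε : ℝ} (hT : 0 ≤ T)
    {X : ℝ → Plane} (hX : ContinuousOn X (Set.Icc 0 T)) :
    ∃ φ : ℝ → ℝ, φ 0 = 0 ∧
      ∀ t ∈ Set.Icc 0 T, HasDerivWithinAt φ (b (X t) / ε) (Set.Icc 0 T) t := by
  set f : ℝ → ℝ := fun t => b (X (Set.projIcc 0 T hT t)) / ε with hf
  have hfc : Continuous f :=
    (hb.comp ((continuousOn_iff_continuous_domRestrict.1 hX).comp continuous_projIcc)).div_const ε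
  refine ⟨fun t => ∫ s in (0 : ℝ)..t, f s, intervalIntegral.integral_same, fun t ht => ?_⟩
  have := (intervalIntegral.integral_hasDerivAt_right (hfc.intervalIntegrable 0 t)
    hfc.aestronglyMeasurable.stronglyMeasurableAtFilter hfc.continuousAt).hasDerivWithinAt
    (s := Set.Icc 0 T)
  refine this.congr_deriv ?_
  simp only [hf, Set.projIcc_of_mem hT ht]

/-- Representation of Lipschitz solutions by characteristics: the flow of a solution consists of
characteristics, and the solution is carried by them. -/
theorem IsBurgersSolution.exists_transport {b : Plane → ℝ} {m L r ε T R : ℝ}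
    {u₀ : Plane → Plane} {u : ℝ → Plane → Plane} (hs : IsBurgersSolution r ε T b u₀ u)
    (hf : FieldBounds b m L) (hε : 0 < ε) (hT : 0 ≤ T) (hR : ∀ᵐ x, ‖u₀ x‖ ≤ R) :
    ∃ (X : Plane → ℝ → Plane) (φ : Plane → ℝ → ℝ) (C : NNReal),
      (∀ x, IsCharacteristic ε T b (u 0 x) x (X x) (φ x)) ∧
      (∀ x, ∀ t ∈ Set.Icc 0 T, u t (X x t) = rot (φ x t) (u 0 x)) ∧
      (∀ t ∈ Set.Icc 0 T, Continuous fun x => φ x t) ∧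
      (∀ t ∈ Set.Icc 0 T, AntilipschitzWith C (fun x => X x t)) ∧
      ∀ t ∈ Set.Icc 0 T, Function.Surjective (fun x => X x t) := by
  obtain ⟨K, hlip⟩ := hs.lipschitz
  have hL := hf.pos_upper
  have h0 : (0 : ℝ) ∈ Set.Icc 0 T := ⟨le_rfl, hT⟩
  have hT' : T ∈ Set.Icc 0 T := ⟨hT, le_rfl⟩
  have hu0 : ∀ x, ‖u 0 x‖ ≤ R := (hlip.space h0).continuous.norm_le_of_ae (by
    filter_upwards [hs.initial, hR] with x hx hx' using hx ▸ hx')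
  have huR : ∀ t ∈ Set.Icc 0 T, ∀ x, ‖u t x‖ ≤ R + K * T := by
    intro t ht x
    have h1 := (hlip.time x).dist_le_mul t ht 0 h0
    rw [dist_eq_norm, Real.dist_eq, sub_zero, abs_of_nonneg ht.1] at h1
    have h2 : K * t ≤ K * T := mul_le_mul_of_nonneg_left ht.2 K.2
    linarith [norm_le_norm_add_norm_sub' (u t x) (u 0 x), hu0 x]
  obtain ⟨X, C, hX0, hX, hXl, hXa, hXs⟩ := exists_flow hT hlip huR
  have hXc : ∀ x, ContinuousOn (X x) (Set.Icc 0 T) := fun x t ht => (hX x t ht).continuousWithinAt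
  choose φ hφ0 hφ using fun x => exists_phase_along hf.lipschitzWith.continuous (ε := ε) hT (hXc x)
  have hφc : ∀ t ∈ Set.Icc 0 T, LipschitzWith (L * C / ε * T).toNNReal fun x => φ x t := by
    refine fun t ht => LipschitzWith.of_dist_le_mul fun x y => ?_
    rw [Real.coe_toNNReal _ (by positivity)]
    have h1 := norm_sub_zero_le_of_hasDerivWithinAt (C := L * (C * dist x y) / ε)
      (fun t ht => (hφ x t ht).sub (hφ y t ht)) (fun t ht => by
        rw [Real.norm_eq_abs, ← sub_div, abs_div, abs_of_pos hε]
        have h2 := hf.abs_sub_le (X x t) (X y t)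
        have h3 := (hXl t ht).dist_le_mul x y
        rw [dist_eq_norm (X x t)] at h3
        gcongr
        exact h2.trans (by gcongr)) ht
    simp only [Pi.sub_apply, hφ0, sub_zero] at h1
    rw [dist_eq_norm (φ x t)]
    have h4 := ht.2
    calc _ ≤ _ := h1
      _ ≤ L * (C * dist x y) / ε * T := by gcongr
      _ = _ := by ring
  have hXt : ∀ x, LipschitzOnWith (R + K * T).toNNReal (X x) (Set.Icc 0 T) := fun x =>
    LipschitzOnWith.of_dist_le_mul fun s hs t ht => by
      rw [Real.coe_toNNReal _ ((norm_nonneg _).trans (huR 0 h0 0)), dist_eq_norm, Real.dist_eq]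
      exact norm_sub_le_of_hasDerivWithinAt (hX x) (fun t ht => huR t ht _) ht hs
  -- almost everywhere in space-time, `u` is differentiable and the equation holds
  have hgood : ∀ᵐ p : ℝ × Plane, p.1 ∈ Set.Ioo 0 T →
      ∃ D : ℝ × Plane →L[ℝ] Plane, HasFDerivAt (fun p : ℝ × Plane => u p.1 p.2) D p ∧
        D (1, 0) + D.comp (ContinuousLinearMap.inr ℝ ℝ Plane) (u p.1 p.2)
          = -((b p.2 / ε) • perp (u p.1 p.2)) := by
    have heq := hs.equation
    rw [ae_restrict_iff' (measurableSet_Ioo.prod MeasurableSet.univ)] at heq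
    filter_upwards [heq, hlip.ae_differentiableWithinAt_of_mem (μ := volume)] with p hp hd hpT
    obtain ⟨dt, dx, h1, h2, h3⟩ := hp ⟨hpT, trivial⟩
    have hD := ((hd ⟨Set.Ioo_subset_Icc_self hpT, trivial⟩).differentiableAt
      (Icc_prod_univ_mem_nhds hpT)).hasFDerivAt
    refine ⟨_, hD, ?_⟩
    rw [hD.partials.1.unique h1, hD.partials.2.1.unique h2]
    exact eq_neg_of_add_eq_zero_left h3
  have hconst : ∀ᵐ x : Plane, ∀ t ∈ Set.Icc 0 T, rot (-φ x t) (u t (X x t)) = u 0 x := by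
    filter_upwards [ae_ae_along_flow hT hXl hXa hXt hgood] with x hx
    have hφl : ∀ s ∈ Set.Icc 0 T, ∀ t ∈ Set.Icc 0 T, |φ x s - φ x t| ≤ L / ε * |s - t| := by
      intro s hs t ht
      refine norm_sub_le_of_hasDerivWithinAt (hφ x) (fun t ht => ?_) ht hs
      rw [Real.norm_of_nonneg (div_nonneg (hf.pos_at _).le hε.le)]
      have := hf.le_upper (X x t)
      gcongr
    have hVl : LipschitzOnWith (K * max 1 (R + K * T).toNNReal) (fun t => u t (X x t))
        (Set.Icc 0 T) :=
      LipschitzOnWith.comp (g := fun p : ℝ × Plane => u p.1 p.2) (f := fun t => (t, X x t)) hlip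
        (LipschitzOnWith.prodMk LipschitzWith.id.lipschitzOnWith (hXt x)) fun t ht => ⟨ht, trivial⟩
    have hR0 : 0 ≤ R + K * T := (norm_nonneg _).trans (huR 0 h0 0)
    have hWl : LipschitzOnWith (K * max 1 (R + K * T).toNNReal
        + ((R + K * T) * (L / ε)).toNNReal) (fun t => rot (-φ x t) (u t (X x t)))
        (Set.uIcc 0 T) := by
      rw [Set.uIcc_of_le hT]
      refine LipschitzOnWith.of_dist_le_mul fun s hs t ht => ?_
      rw [NNReal.coe_add, Real.coe_toNNReal _ (by positivity), add_mul, dist_eq_norm]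
      refine (norm_rot_sub_rot_le' _ _ _ _).trans (add_le_add ?_ ?_)
      · rw [← dist_eq_norm]; exact hVl.dist_le_mul s hs t ht
      · have h1 := hφl s hs t ht
        have h2 := huR t ht (X x t)
        rw [neg_sub_neg, abs_sub_comm, mul_assoc, Real.dist_eq]
        gcongr
    obtain ⟨c, hc⟩ := hWl.absolutelyContinuousOnInterval.const_of_ae_hasDerivAt_zero (by
      rw [Set.uIcc_of_le hT]
      filter_upwards [hx, (Set.countable_singleton (0 : ℝ)).ae_notMem volume,
        (Set.countable_singleton T).ae_notMem volume] with t h1 h2 h3 ht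
      have hto : t ∈ Set.Ioo 0 T := ⟨lt_of_le_of_ne ht.1 (Ne.symm h2), lt_of_le_of_ne ht.2 h3⟩
      have hn : Set.Icc 0 T ∈ 𝓝 t := Icc_mem_nhds hto.1 hto.2
      obtain ⟨D, hD, hDe⟩ := h1 ht hto
      refine hasDerivAt_rot_neg_zero ((hφ x t ht).hasDerivAt hn) ?_
      exact (hD.partials.2.2 rfl ((hX x t ht).hasDerivAt hn)).congr_deriv hDe)
    rw [Set.uIcc_of_le hT] at hc
    intro t ht
    have h1 := hc 0 h0
    simp only [hφ0, hX0, neg_zero, rot_zero] at h1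
    rw [hc t ht, ← h1]
  have hrep : ∀ x, ∀ t ∈ Set.Icc 0 T, u t (X x t) = rot (φ x t) (u 0 x) := by
    intro x t ht
    have c1 : Continuous fun x => rot (-φ x t) (u t (X x t)) := by
      have h1 : Continuous fun x => u t (X x t) :=
        (hlip.space ht).continuous.comp (hXl t ht).continuous
      have h2 := (hφc t ht).continuous
      have h3 : Continuous fun x => perp (u t (X x t)) := perpL.continuous.comp h1
      exact ((Real.continuous_cos.comp h2.neg).smul h1).sub
        ((Real.continuous_sin.comp h2.neg).smul h3)
    have := (c1.ae_eq_iff_eq volume (hlip.space h0).continuous).1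
      (by filter_upwards [hconst] with x hx using hx t ht)
    rw [← congrFun this x, rot_rot_neg]
  exact ⟨X, φ, C, fun x => ⟨hX0 x, hφ0 x, fun t ht => by
      rw [← hrep x t ht]; exact hX x t ht, hφ x⟩, hrep, fun t ht => (hφc t ht).continuous, hXa, hXs⟩

/-- Uniqueness: two solutions with the same data have the same characteristics. -/
theorem IsBurgersSolution.unique {b : Plane → ℝ} {m L r ε T R : ℝ}
    {u₀ : Plane → Plane} {u v : ℝ → Plane → Plane} (hu : IsBurgersSolution r ε T b u₀ u)
    (hv : IsBurgersSolution r ε T b u₀ v)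
    (hf : FieldBounds b m L) (hε : 0 < ε) (hT : 0 ≤ T) (hR : ∀ᵐ x, ‖u₀ x‖ ≤ R) {t : ℝ}
    (ht : t ∈ Set.Icc 0 T) (y : Plane) : u t y = v t y := by
  have h0 : (0 : ℝ) ∈ Set.Icc 0 T := ⟨le_rfl, hT⟩
  have e0 : u 0 = v 0 := by
    obtain ⟨K, hK⟩ := hu.lipschitz
    obtain ⟨K', hK'⟩ := hv.lipschitz
    exact ((hK.space h0).continuous.ae_eq_iff_eq volume (hK'.space h0).continuous).1
      (hu.initial.trans hv.initial.symm)
  obtain ⟨X, φ, -, hc, hrep, -, -, hsurj⟩ := hu.exists_transport hf hε hT hR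
  obtain ⟨X', φ', -, hc', hrep', -⟩ := hv.exists_transport hf hε hT hR
  obtain ⟨x, rfl⟩ := hsurj t ht y
  have hcx := hc' x
  rw [← e0] at hcx
  obtain ⟨e1, e2⟩ := (hc x).eqOn hf hε hT hcx ht
  show u t (X x t) = v t (X x t)
  rw [hrep x t ht, e1, hrep' x t ht, e2, e0]

/-! ### The implicit phase equation -/

theorem rot_sub_rot (θ θ' : ℝ) (w : Plane) :
    rot θ w - rot θ' w = (-(2 * Real.sin ((θ - θ') / 2))) • perp (rot ((θ + θ') / 2) w) := by
  have h1 := Real.cos_sub_cos θ θ'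
  have h2 := Real.sin_sub_sin θ θ'
  have e : rot θ w - rot θ' w =
      (Real.cos θ - Real.cos θ') • w - (Real.sin θ - Real.sin θ') • perp w := by
    simp only [rot]; module
  rw [e, h1, h2, perp_rot]
  module

theorem norm_rot_sub_rot (θ θ' : ℝ) (w : Plane) :
    ‖rot θ w - rot θ' w‖ = 2 * |Real.sin ((θ - θ') / 2)| * ‖w‖ := by
  rw [rot_sub_rot, norm_smul, norm_perp, norm_rot, Real.norm_eq_abs, abs_neg, abs_mul, abs_two]

/-- The left-hand side of the phase equation `θ + t ∇log b · (rot θ w)^⊥ = b t / ε`. -/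
noncomputable def phaseMap (t : ℝ) (ℓ : Plane →L[ℝ] ℝ) (w : Plane) (θ : ℝ) : ℝ :=
  θ + t * ℓ (perp (rot θ w))

section PhaseMap

variable {t : ℝ} {ℓ : Plane →L[ℝ] ℝ} {w : Plane}

theorem phaseMap_eq (θ : ℝ) :
    phaseMap t ℓ w θ = θ + t * (Real.cos θ * ℓ (perp w) + Real.sin θ * ℓ w) := by
  simp [phaseMap, perp_rot]

theorem continuous_phaseMap : Continuous (phaseMap t ℓ w) := by
  have : phaseMap t ℓ w = _ := funext phaseMap_eq
  rw [this]
  fun_prop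

theorem hasDerivAt_phaseMap (θ : ℝ) :
    HasDerivAt (phaseMap t ℓ w) (1 + t * ℓ (rot θ w)) θ := by
  have h := (hasDerivAt_id θ).add (((ℓ.comp perpL).hasFDerivAt.comp_hasDerivAt θ
    (hasDerivAt_rot θ w)).const_mul t)
  refine HasDerivAt.congr_deriv (f := phaseMap t ℓ w) h ?_
  simp [perp_neg]

theorem abs_phaseMap_sub_self_le (θ : ℝ) : |phaseMap t ℓ w θ - θ| ≤ |t| * (‖ℓ‖ * ‖w‖) := by
  rw [phaseMap, add_sub_cancel_left, abs_mul]
  gcongr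
  refine (ℓ.le_opNorm _).trans ?_
  rw [norm_perp, norm_rot]

theorem phaseMap_add_int_mul_two_pi (θ : ℝ) (k : ℤ) :
    phaseMap t ℓ w (θ + k * (2 * Real.pi)) = phaseMap t ℓ w θ + k * (2 * Real.pi) := by
  rw [phaseMap_eq, phaseMap_eq, Real.cos_add_int_mul_two_pi, Real.sin_add_int_mul_two_pi]
  ring

/-- Below the critical time the phase map is expanding, up to a cubic defect at the origin. -/
theorem abs_sub_le_abs_phaseMap_sub (ht : 0 ≤ t) (h : t * (‖ℓ‖ * ‖w‖) ≤ 1) (θ θ' : ℝ) :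
    |θ - θ'| - 2 * |Real.sin ((θ - θ') / 2)| ≤ |phaseMap t ℓ w θ - phaseMap t ℓ w θ'| := by
  have e : phaseMap t ℓ w θ - phaseMap t ℓ w θ' =
      (θ - θ') - -(t * ℓ (perp (rot θ w - rot θ' w))) := by
    simp only [phaseMap, perp_sub, map_sub]; ring
  have h1 : |t * ℓ (perp (rot θ w - rot θ' w))| ≤ 2 * |Real.sin ((θ - θ') / 2)| := by
    rw [abs_mul, abs_of_nonneg ht]
    have h2 : |ℓ (perp (rot θ w - rot θ' w))| ≤ ‖ℓ‖ * (2 * |Real.sin ((θ - θ') / 2)| * ‖w‖) := by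
      refine (ℓ.le_opNorm _).trans ?_
      rw [norm_perp, norm_rot_sub_rot]
    have h3 := mul_le_mul_of_nonneg_right h
      (show 0 ≤ 2 * |Real.sin ((θ - θ') / 2)| by positivity)
    have h4 := mul_le_mul_of_nonneg_left h2 ht
    linarith
  rw [e]
  have := abs_sub_abs_le_abs_sub (θ - θ') (-(t * ℓ (perp (rot θ w - rot θ' w))))
  rw [abs_neg] at this
  linarith

theorem existsUnique_phaseMap_eq (ht : 0 ≤ t) (h : t * (‖ℓ‖ * ‖w‖) ≤ 1) (c : ℝ) :
    ∃! θ, phaseMap t ℓ w θ = c := by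
  have hb : ∀ θ, |phaseMap t ℓ w θ - θ| ≤ 1 := fun θ =>
    (abs_phaseMap_sub_self_le θ).trans (by rwa [abs_of_nonneg ht])
  obtain ⟨θ, hθ⟩ := mem_range_of_exists_le_of_exists_ge (f := phaseMap t ℓ w) (c := c)
    continuous_phaseMap
    ⟨c - 1, by linarith [(abs_le.1 (hb (c - 1))).2]⟩ ⟨c + 1, by linarith [(abs_le.1 (hb (c + 1))).1]⟩
  refine ⟨θ, hθ, fun θ' hθ' => ?_⟩
  have h1 := abs_sub_le_abs_phaseMap_sub ht h θ' θ
  rw [hθ, hθ', sub_self, abs_zero] at h1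
  by_contra hne
  have h2 := Real.abs_sin_lt_abs (x := (θ' - θ) / 2) (by
    intro h0
    exact hne (by linarith))
  rw [abs_div, abs_two] at h2
  linarith

/-- A monotone phase map is below the critical time: its derivative at the angle for which
`rot θ w` is opposite to the gradient is `1 - t ‖ℓ‖ ‖w‖`. -/
theorem mul_le_one_of_monotone_phaseMap (h : Monotone (phaseMap t ℓ w)) :
    t * (‖ℓ‖ * ‖w‖) ≤ 1 := by
  set z : ℂ := ⟨ℓ w, ℓ (perp w)⟩ with hz
  have hd : 0 ≤ 1 + t * ℓ (rot (Real.pi - z.arg) w) :=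
    (hasDerivAt_phaseMap _).deriv ▸ h.deriv_nonneg
  have hre : ‖z‖ * Real.cos z.arg = ℓ w := Complex.norm_mul_cos_arg z
  have him : ‖z‖ * Real.sin z.arg = ℓ (perp w) := Complex.norm_mul_sin_arg z
  have hℓ : ℓ (rot (Real.pi - z.arg) w) = -‖z‖ := by
    rw [rot, map_sub, map_smul, map_smul, Real.cos_pi_sub, Real.sin_pi_sub, ← hre, ← him,
      smul_eq_mul, smul_eq_mul]
    linear_combination -‖z‖ * Real.sin_sq_add_cos_sq z.arg
  have hnorm : ‖z‖ = ‖w‖ * ‖ℓ‖ := by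
    have h1 := inner_sq_add_inner_perp_sq w ((InnerProductSpace.toDual ℝ Plane).symm ℓ)
    rw [real_inner_comm, InnerProductSpace.toDual_symm_apply, real_inner_comm,
      InnerProductSpace.toDual_symm_apply, LinearIsometryEquiv.norm_map] at h1
    rw [← sq_eq_sq₀ (norm_nonneg _) (by positivity), ← h1, Complex.sq_norm, Complex.normSq_apply]
    ring
  rw [hℓ, hnorm] at hd
  linarith

end PhaseMap

/-- Let `F` be a lift of a circle map of degree one. If on arbitrarily long intervals there are
continuous `ψ` for which `F ∘ ψ` is arbitrarily close to an affine function of the fixed slope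
`a > 0`, then `F` is monotone. -/
theorem monotone_of_forall_near_affine {F : ℝ → ℝ} {B a : ℝ} (ha : 0 < a)
    (hB : ∀ θ, |F θ - θ| ≤ B)
    (hF : ∀ (θ : ℝ) (k : ℤ), F (θ + k * (2 * Real.pi)) = F θ + k * (2 * Real.pi))
    (h : ∀ M, 0 < M → ∀ η, 0 < η → ∃ (ψ : ℝ → ℝ) (c : ℝ), Continuous ψ ∧
      ∀ τ ∈ Set.Icc 0 M, |F (ψ τ) - (c + a * τ)| ≤ η) : Monotone F := by
  intro θ₁ θ₂ hθ
  have hB0 : 0 ≤ B := (abs_nonneg _).trans (hB 0)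
  have hpi := Real.pi_pos
  have key : ∀ η, 0 < η → η ≤ 1 → F θ₁ ≤ F θ₂ + 2 * η := by
    intro η hη hη1
    -- over `[0, M]` the range of `ψ` contains a translate of `[θ₁, θ₂]` by a multiple of `2π`
    set M := (2 * Real.pi + (θ₂ - θ₁) + 2 * B + 2) / a with hM
    have hM0 : 0 < M := by
      have : 0 ≤ θ₂ - θ₁ := by linarith
      positivity
    obtain ⟨ψ, c, hψ, hc⟩ := h M hM0 η hη
    have haM : a * M = 2 * Real.pi + (θ₂ - θ₁) + 2 * B + 2 := mul_div_cancel₀ _ ha.ne'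
    have h0 := abs_le.1 (hc 0 ⟨le_rfl, hM0.le⟩)
    have h1 := abs_le.1 (hc M ⟨hM0.le, le_rfl⟩)
    have h2 := abs_le.1 (hB (ψ 0))
    have h3 := abs_le.1 (hB (ψ M))
    set k := ⌈(ψ 0 - θ₁) / (2 * Real.pi)⌉ with hk
    have k1 : ψ 0 - θ₁ ≤ k * (2 * Real.pi) := by
      rw [← div_le_iff₀ (by positivity)]; exact Int.le_ceil _
    have k2 : k * (2 * Real.pi) ≤ ψ 0 - θ₁ + 2 * Real.pi := by
      have := (Int.ceil_lt_add_one ((ψ 0 - θ₁) / (2 * Real.pi))).le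
      rw [← hk, div_add_one (by positivity), le_div_iff₀ (by positivity)] at this
      exact this
    obtain ⟨τ₁, hτ₁, e1⟩ := intermediate_value_Icc hM0.le hψ.continuousOn
      (show θ₁ + k * (2 * Real.pi) ∈ Set.Icc (ψ 0) (ψ M) from ⟨by linarith, by linarith⟩)
    obtain ⟨τ₂, hτ₂, e2⟩ := intermediate_value_Icc hτ₁.2 hψ.continuousOn
      (show θ₂ + k * (2 * Real.pi) ∈ Set.Icc (ψ τ₁) (ψ M) from ⟨by linarith, by linarith⟩)
    have h4 := abs_le.1 (hc τ₁ hτ₁)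
    have h5 := abs_le.1 (hc τ₂ ⟨hτ₁.1.trans hτ₂.1, hτ₂.2⟩)
    rw [e1, hF] at h4
    rw [e2, hF] at h5
    have h6 := mul_le_mul_of_nonneg_left hτ₂.1 ha.le
    linarith
  refine le_of_forall_pos_le_add fun η hη => ?_
  have := key (min (η / 2) 1) (by positivity) (min_le_right _ _)
  linarith [min_le_left (η / 2) 1]

/-- Quantitative strictness in `|sin x| ≤ |x|`. -/
theorem exists_le_abs_sub_abs_sin {η : ℝ} (hη : 0 < η) :
    ∃ ν, 0 < ν ∧ ∀ x : ℝ, η ≤ |x| → ν ≤ |x| - |Real.sin x| := by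
  refine ⟨min (η - Real.sin η) 1, lt_min (by linarith [Real.sin_lt hη]) one_pos, fun x hx => ?_⟩
  have e : |Real.sin x| = |Real.sin (|x|)| := by
    rcases abs_choice x with h | h <;> simp [h]
  rw [e]
  generalize |x| = y at hx
  rcases le_total 2 y with h2 | h2
  · exact (min_le_right _ _).trans (by linarith [Real.abs_sin_le_one y])
  · refine (min_le_left _ _).trans ?_
    rw [abs_of_nonneg (Real.sin_nonneg_of_nonneg_of_le_pi (hη.le.trans hx)
      (h2.trans Real.two_le_pi))]
    have h3 : Real.sin y - Real.sin η ≤ y - η := by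
      rw [Real.sin_sub_sin]
      have h4 := Real.sin_le (x := (y - η) / 2) (by linarith)
      have h5 := Real.cos_le_one ((y + η) / 2)
      have h6 := Real.sin_nonneg_of_nonneg_of_le_pi (x := (y - η) / 2) (by linarith)
        (by linarith [Real.two_le_pi])
      have h7 := mul_le_mul_of_nonneg_left h5 h6
      linarith
    linarith

/-! ### Convergence -/

/-- At the phase accumulated along the characteristics, which depends continuously on the position,
the solution is `O(ε)`-close to the rotated initial velocity and the phase equation holds up
to `O(ε)`. -/
theorem exists_approximate_phase {b : Plane → ℝ} {m L r T εT R : ℝ} {K : NNReal}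
    {u₀ v : Plane → Plane} {u : ℝ → ℝ → Plane → Plane} (hf : FieldBounds b m L) (hR : 0 < R)
    (hT : 0 ≤ T) (hv : LipschitzWith K v) (hvR : ∀ x, ‖v x‖ ≤ R) (huv : u₀ =ᵐ[volume] v)
    (hs : ∀ ε ∈ Set.Ioc 0 εT, IsBurgersSolution r ε T b u₀ (u ε)) :
    ∃ C, 0 ≤ C ∧ ∀ ε ∈ Set.Ioc 0 εT, ∃ ψ : ℝ → Plane → ℝ, ∀ t ∈ Set.Icc 0 T,
      Continuous (ψ t) ∧ ∀ y, ‖u ε t y - rot (ψ t y) (v y)‖ ≤ C * ε ∧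
        |phaseMap t (logFDeriv b y) (v y) (ψ t y) - b y * t / ε| ≤ C * ε := by
  obtain ⟨C, hC, hphase⟩ := exists_phase_bound (m := m) (L := L) hR hT
  have hL := hf.pos_upper
  have hm : 0 < m⁻¹ := inv_pos.2 hf.pos
  refine ⟨K * C + (C + T * (m⁻¹ * L * (K * C))), by positivity, fun ε hε => ?_⟩
  have hε0 : 0 < ε := hε.1
  have hsol := hs ε hε
  have e0 : u ε 0 = v := by
    obtain ⟨K', hK'⟩ := hsol.lipschitz
    exact ((hK'.space ⟨le_rfl, hT⟩).continuous.ae_eq_iff_eq volume hv.continuous).1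
      (hsol.initial.trans huv)
  obtain ⟨X, φ, A, hc, hrep, hφ, hXa, hXs⟩ := hsol.exists_transport hf hε.1 hT
    (huv.mono fun x hx => hx ▸ hvR x)
  simp only [e0] at hc hrep
  choose! Y hY using show ∀ t ∈ Set.Icc 0 T, ∀ y, ∃ x, X x t = y from hXs
  refine ⟨fun t y => φ (Y t y) t, fun t ht => ⟨?_, fun y => ?_⟩⟩
  · exact (hφ t ht).comp ((hXa t ht).to_rightInverse fun y => hY t ht y).continuous
  · obtain ⟨x, hxY, rfl⟩ : ∃ x, x = Y t y ∧ X x t = y := ⟨_, rfl, hY t ht y⟩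
    simp only [← hxY]
    obtain ⟨h1, h2⟩ := hphase b hf ε hε.1 (v x) x (X x) (φ x) (hvR x) (hc x) t ht
    have h3 : ‖v x - v (X x t)‖ ≤ K * C * ε := by
      rw [norm_sub_rev, mul_assoc]
      exact (hv.norm_sub_le _ _).trans (mul_le_mul_of_nonneg_left h1 K.2)
    constructor
    · rw [hrep x t ht, ← rot_sub, norm_rot]
      refine h3.trans ?_
      gcongr
      have : 0 ≤ C + T * (m⁻¹ * L * (K * C)) := by positivity
      linarith
    · have e : phaseMap t (logFDeriv b (X x t)) (v (X x t)) (φ x t) - b (X x t) * t / ε =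
          (φ x t - (b (X x t) * t / ε - t * logFDeriv b (X x t) (perp (rot (φ x t) (v x)))))
          - t * logFDeriv b (X x t) (perp (rot (φ x t) (v x - v (X x t)))) := by
        rw [phaseMap, rot_sub, perp_sub, map_sub]; ring
      have h4 : |t * logFDeriv b (X x t) (perp (rot (φ x t) (v x - v (X x t))))| ≤
          T * (m⁻¹ * L * (K * C * ε)) := by
        rw [abs_mul, abs_of_nonneg ht.1]
        have h5 : |logFDeriv b (X x t) (perp (rot (φ x t) (v x - v (X x t))))| ≤
            m⁻¹ * L * (K * C * ε) := by
          refine ((logFDeriv b (X x t)).le_of_opNorm_le (hf.norm_logFDeriv_le _) _).trans ?_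
          rw [norm_perp, norm_rot]
          gcongr
        have := ht.2
        gcongr
      rw [e]
      refine (abs_sub _ _).trans ((add_le_add h2 h4).trans ?_)
      have : 0 ≤ K * C * ε := by positivity
      linarith

/-- A uniform existence time is at most the first critical time of the phase equation. Otherwise
the accumulated phase, being continuous in the position, would have to run through a whole
period, including an interval where the phase map decreases, while `b t / ε` increases. -/
theorem mul_norm_logFDeriv_le_one {b : Plane → ℝ} {m L T εT R C : ℝ} {K : NNReal}
    {v : Plane → Plane} (hf : FieldBounds b m L) (hT : 0 < T) (hεT : 0 < εT)
    (hv : LipschitzWith K v) (hvR : ∀ x, ‖v x‖ ≤ R) (hC : 0 ≤ C)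
    (h : ∀ ε ∈ Set.Ioc 0 εT, ∃ ψ : Plane → ℝ, Continuous ψ ∧ ∀ y,
      |phaseMap T (logFDeriv b y) (v y) (ψ y) - b y * T / ε| ≤ C * ε) (x : Plane) :
    T * (‖logFDeriv b x‖ * ‖v x‖) ≤ 1 := by
  have hL := hf.pos_upper
  have hm : 0 < m⁻¹ := inv_pos.2 hf.pos
  have hR : 0 ≤ R := (norm_nonneg _).trans (hvR 0)
  by_cases hg : fderiv ℝ b x = 0
  · simp [logFDeriv, hg]
  obtain ⟨e, he⟩ : ∃ e, fderiv ℝ b x e = 1 := by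
    obtain ⟨e, he⟩ : ∃ e, fderiv ℝ b x e ≠ 0 := by
      by_contra! hcon
      exact hg (ContinuousLinearMap.ext hcon)
    exact ⟨(fderiv ℝ b x e)⁻¹ • e, by rw [map_smul, smul_eq_mul, inv_mul_cancel₀ he]⟩
  refine mul_le_one_of_monotone_phaseMap (monotone_of_forall_near_affine hT
    (fun θ => abs_phaseMap_sub_self_le θ) (fun θ k => phaseMap_add_int_mul_two_pi θ k)
    fun M hM η hη => ?_)
  -- follow the phase along a segment of length of order `ε` in a direction where `b` increases
  set A := m⁻¹ * L + m⁻¹ * m⁻¹ * L * L with hA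
  have hA0 : 0 ≤ A := by positivity
  set B := C + T * (A * (M * ‖e‖) * R + m⁻¹ * L * (K * (M * ‖e‖))) + T * (L * (M * ‖e‖) ^ 2)
    with hB
  have hB0 : 0 ≤ B := by positivity
  set ε := min εT (η / (B + 1)) with hεdef
  have hε : 0 < ε := lt_min hεT (by positivity)
  have hBε : B * ε ≤ η := by
    have h1 : B * ε ≤ B * (η / (B + 1)) := mul_le_mul_of_nonneg_left (min_le_right _ _) hB0
    refine h1.trans ?_
    rw [mul_div_assoc', div_le_iff₀ (by positivity)]
    linarith
  obtain ⟨ψ, hψ, hψy⟩ := h ε ⟨hε, min_le_left _ _⟩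
  refine ⟨fun τ => ψ (x + (ε * τ) • e), b x * T / ε, by fun_prop, fun τ hτ => ?_⟩
  have hτ0 := hτ.1
  set y := x + (ε * τ) • e with hy
  have hyx : ‖y - x‖ ≤ M * ‖e‖ * ε := by
    rw [hy, add_sub_cancel_left, norm_smul, Real.norm_of_nonneg (by positivity)]
    have := hτ.2
    calc _ ≤ ε * M * ‖e‖ := by gcongr
      _ = _ := by ring
  have h1 := hψy y
  have h2 : |T * (logFDeriv b x (perp (rot (ψ y) (v x)))
      - logFDeriv b y (perp (rot (ψ y) (v y))))| ≤
      T * (A * (M * ‖e‖) * R + m⁻¹ * L * (K * (M * ‖e‖))) * ε := by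
    have e1 : logFDeriv b x (perp (rot (ψ y) (v x))) - logFDeriv b y (perp (rot (ψ y) (v y))) =
        -((logFDeriv b y - logFDeriv b x) (perp (rot (ψ y) (v y)))
          + logFDeriv b x (perp (rot (ψ y) (v y - v x)))) := by
      rw [sub_apply, rot_sub, perp_sub, map_sub]; ring
    have e2 : |(logFDeriv b y - logFDeriv b x) (perp (rot (ψ y) (v y)))| ≤
        A * (M * ‖e‖ * ε) * R := by
      refine (ContinuousLinearMap.le_opNorm (logFDeriv b y - logFDeriv b x) _).trans ?_
      rw [norm_perp, norm_rot]
      exact mul_le_mul ((hf.norm_logFDeriv_sub_le y x).trans (by gcongr)) (hvR y) (norm_nonneg _)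
        (by positivity)
    have e3 : |logFDeriv b x (perp (rot (ψ y) (v y - v x)))| ≤
        m⁻¹ * L * (K * (M * ‖e‖ * ε)) := by
      refine ((logFDeriv b x).le_of_opNorm_le (hf.norm_logFDeriv_le x) _).trans ?_
      rw [norm_perp, norm_rot]
      have := (hv.norm_sub_le y x).trans (mul_le_mul_of_nonneg_left hyx K.2)
      gcongr
    rw [abs_mul, abs_of_pos hT, e1, abs_neg]
    calc _ ≤ T * (A * (M * ‖e‖ * ε) * R + m⁻¹ * L * (K * (M * ‖e‖ * ε))) := by
          gcongr
          exact (abs_add_le _ _).trans (add_le_add e2 e3)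
      _ = _ := by ring
  have h3 : |b y * T / ε - (b x * T / ε + T * τ)| ≤ T * (L * (M * ‖e‖) ^ 2) * ε := by
    have e1 := hf.abs_taylor_le x y
    have e2 : fderiv ℝ b x (y - x) = ε * τ := by
      rw [hy, add_sub_cancel_left, map_smul, he, smul_eq_mul, mul_one]
    rw [e2] at e1
    have e3 : b y * T / ε - (b x * T / ε + T * τ) = T / ε * (b y - b x - ε * τ) := by
      field_simp
      ring
    rw [e3, abs_mul, abs_of_pos (div_pos hT hε)]
    calc _ ≤ T / ε * (L * (M * ‖e‖ * ε) ^ 2) := by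
          gcongr
          exact e1.trans (by gcongr)
      _ = _ := by field_simp
  have e4 : phaseMap T (logFDeriv b x) (v x) (ψ y) - (b x * T / ε + T * τ) =
      (phaseMap T (logFDeriv b y) (v y) (ψ y) - b y * T / ε)
      + T * (logFDeriv b x (perp (rot (ψ y) (v x))) - logFDeriv b y (perp (rot (ψ y) (v y))))
      + (b y * T / ε - (b x * T / ε + T * τ)) := by
    simp only [phaseMap]; ring
  rw [e4]
  refine (abs_add_le _ _).trans ((add_le_add ((abs_add_le _ _).trans (add_le_add h1 h2))
    h3).trans (le_trans (le_of_eq ?_) hBε))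
  rw [hB]; ring

theorem inner_gradient_log {b : Plane → ℝ} {m L : ℝ} (hf : FieldBounds b m L) (w x : Plane) :
    inner ℝ w (gradient (fun y => Real.log (b y)) x) = logFDeriv b x w := by
  have h := ((hf.differentiable x).hasFDerivAt.log (hf.pos_at x).ne').fderiv
  rw [real_inner_comm, gradient, InnerProductSpace.toDual_symm_apply, h, logFDeriv]

theorem isPhase_iff {b : Plane → ℝ} {m L : ℝ} (hf : FieldBounds b m L) {ε t θ : ℝ}
    {u₀ : Plane → Plane} {x : Plane} :
    IsPhase ε b u₀ t x θ ↔ phaseMap t (logFDeriv b x) (u₀ x) θ = b x * t / ε := by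
  rw [IsPhase, inner_gradient_log hf, inner_gradient_log hf, phaseMap_eq]
  constructor <;> intro h <;> linarith

theorem theorem3 (b : Plane → ℝ) (u₀ : Plane → Plane) (s : ℝ)
    (hb_smooth : ContDiff ℝ ∞ b) (hb_sobolev : MemSobolevInf 2 b)
    (hb_pos : ∃ bmin : ℝ, 0 < bmin ∧ ∀ x, bmin ≤ b x)
    (hs : 1 ≤ s) (hu₀ : MemSobolevInf s u₀) :
    -- solutions exist and are unique on a time interval that does not shrink with `ε`
    (∃ Tstar : ℝ≥0∞, 0 < Tstar ∧ ∀ T : ℝ, 0 < T → ENNReal.ofReal T < Tstar →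
      ∃ εT : ℝ, 0 < εT ∧ ∀ ε ∈ Set.Ioc 0 εT,
        (∃ u, IsBurgersSolution 1 ε T b u₀ u) ∧
        ∀ u v, IsBurgersSolution 1 ε T b u₀ u → IsBurgersSolution 1 ε T b u₀ v →
          ∀ t ∈ Set.Icc 0 T, ∀ x, u t x = v t x) ∧
    -- on every time interval of uniform existence the phase is well defined and describes `u`
    (∀ r T εT : ℝ, 1 ≤ r → r ≤ s → 0 < T → 0 < εT → ∀ u : ℝ → ℝ → Plane → Plane,
      (∀ ε ∈ Set.Ioc 0 εT, IsBurgersSolution r ε T b u₀ (u ε)) →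
      (∀ᵐ x : Plane, ∀ ε ∈ Set.Ioc 0 εT, ∀ t ∈ Set.Icc 0 T, ∃! θ : ℝ, IsPhase ε b u₀ t x θ) ∧
      ∀ θ : ℝ → ℝ → Plane → ℝ,
        (∀ ε ∈ Set.Ioc 0 εT, ∀ᵐ p : ℝ × Plane ∂(volume.restrict (Set.Icc 0 T ×ˢ Set.univ)),
          IsPhase ε b u₀ p.1 p.2 (θ ε p.1 p.2)) →
        Tendsto (fun ε : ℝ => eLpNorm
            (fun p : ℝ × Plane => u ε p.1 p.2 -
              (Real.cos (θ ε p.1 p.2) • u₀ p.2 - Real.sin (θ ε p.1 p.2) • perp (u₀ p.2)))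
            ∞ (volume.restrict (Set.Icc 0 T ×ˢ Set.univ)))
          (𝓝[>] 0) (𝓝 0)) := by
  obtain ⟨m, hm, hmb⟩ := hb_pos
  obtain ⟨L, hf⟩ := exists_fieldBounds hb_smooth hb_sobolev hm hmb
  obtain ⟨K, v, hv, huv⟩ := hu₀.exists_lipschitzWith hs
  obtain ⟨R₀, hR₀⟩ := hu₀.ae_bound
  set R := max R₀ 1 with hRdef
  have hR : 0 < R := lt_max_of_lt_right one_pos
  have huR : ∀ᵐ x, ‖u₀ x‖ ≤ R := hR₀.mono fun x hx => hx.trans (le_max_left _ _)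
  have hvR : ∀ x, ‖v x‖ ≤ R := hv.continuous.norm_le_of_ae (by
    filter_upwards [huv, huR] with x hx hx' using hx ▸ hx')
  refine ⟨?_, fun r T εT _ _ hT hεT u hu => ?_⟩
  · obtain ⟨τ, hτ, hex⟩ := exists_isBurgersSolution hf hR hv hvR huv
    refine ⟨ENNReal.ofReal τ, ENNReal.ofReal_pos.2 hτ, fun T hT hTτ => ⟨τ, hτ, fun ε hε => ⟨?_, ?_⟩⟩⟩
    · exact hex T hT ((ENNReal.ofReal_lt_ofReal_iff hτ).1 hTτ).le ε hε.1 hε.2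
    · exact fun u v hu hv t ht x => hu.unique hv hf hε.1 hT.le huR ht x
  · obtain ⟨C, hC, hψ⟩ := exists_approximate_phase hf hR hT.le hv hvR huv hu
    have hcrit : ∀ x, ∀ t ∈ Set.Icc 0 T, t * (‖logFDeriv b x‖ * ‖v x‖) ≤ 1 := by
      intro x t ht
      refine le_trans (mul_le_mul_of_nonneg_right ht.2 (by positivity))
        (mul_norm_logFDeriv_le_one hf hT hεT hv hvR hC (fun ε hε => ?_) x)
      obtain ⟨ψ, hψ⟩ := hψ ε hε
      exact ⟨ψ T, (hψ T ⟨hT.le, le_rfl⟩).1, fun y => ((hψ T ⟨hT.le, le_rfl⟩).2 y).2⟩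
    refine ⟨?_, fun θ hθ => ?_⟩
    · filter_upwards [huv] with x hx ε _ t ht
      simp only [isPhase_iff hf, hx]
      exact existsUnique_phaseMap_eq ht.1 (hcrit x t ht) _
    · rw [ENNReal.tendsto_nhds_zero]
      intro e he
      rcases eq_or_ne e ∞ with rfl | hetop
      · exact Eventually.of_forall fun _ => le_top
      have he' : 0 < e.toReal := ENNReal.toReal_pos he.ne' hetop
      set η := e.toReal / (2 * R) with hη
      have hη0 : 0 < η := by positivity
      obtain ⟨ν, hν, hsin⟩ := exists_le_abs_sub_abs_sin (half_pos hη0)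
      have hsmall : ∀ᶠ ε : ℝ in 𝓝[>] 0, C * ε < min (e.toReal / 2) ν := by
        have h1 : Tendsto (fun ε : ℝ => C * ε) (𝓝[>] 0) (𝓝 0) := by
          have : Tendsto (fun ε : ℝ => C * ε) (𝓝 0) (𝓝 (C * 0)) := tendsto_id.const_mul C
          rw [mul_zero] at this
          exact this.mono_left nhdsWithin_le_nhds
        exact h1.eventually_lt_const (by positivity)
      filter_upwards [hsmall, Ioc_mem_nhdsGT hεT] with ε hε hεI
      obtain ⟨ψ, hψ⟩ := hψ ε hεI
      have huv' : ∀ᵐ p : ℝ × Plane, u₀ p.2 = v p.2 :=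
        (Measure.quasiMeasurePreserving_snd (μ := (volume : Measure ℝ))
          (ν := (volume : Measure Plane))).ae huv
      rw [eLpNorm_exponent_top, ← ENNReal.ofReal_toReal hetop]
      refine eLpNormEssSup_le_of_ae_bound ?_
      filter_upwards [hθ ε hεI, ae_restrict_of_ae huv',
        ae_restrict_mem (measurableSet_Icc.prod MeasurableSet.univ)] with p hp hpv hpT
      have ht := hpT.1
      rw [isPhase_iff hf, hpv] at hp
      rw [hpv]
      set ϑ := θ ε p.1 p.2
      obtain ⟨h1, h2⟩ := (hψ p.1 ht).2 p.2
      set χ := ψ p.1 p.2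
      have h3 := abs_sub_le_abs_phaseMap_sub ht.1 (hcrit p.2 p.1 ht) χ ϑ
      rw [hp] at h3
      have h4 : |χ - ϑ| ≤ η := by
        by_contra! hcon
        have := hsin ((χ - ϑ) / 2) (by rw [abs_div, abs_two]; linarith)
        rw [abs_div, abs_two] at this
        linarith [hε.le.trans (min_le_right _ _)]
      have h5 := norm_rot_sub_rot_le χ ϑ (v p.2)
      have h6 : ‖v p.2‖ * |χ - ϑ| ≤ e.toReal / 2 := by
        calc _ ≤ R * η := by
              have := hvR p.2
              gcongr
          _ = _ := by rw [hη]; field_simp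
      have h7 : u ε p.1 p.2 - (Real.cos ϑ • v p.2 - Real.sin ϑ • perp (v p.2)) =
          (u ε p.1 p.2 - rot χ (v p.2)) + (rot χ (v p.2) - rot ϑ (v p.2)) :=
        (sub_add_sub_cancel _ _ _).symm
      rw [h7]
      refine (norm_add_le _ _).trans ?_
      linarith [hε.le.trans (min_le_left _ _)]
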